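/- Let $P(t)=\{p_1(t),\dots,p_n(t)\}$ be points moving continuously in the plane, $t\in\mathbb R$, such that any two of them have equal $x$-coordinates at most $k$ times and any three of them are collinear at most $s$ times. Fix a permutation $\pi$ of the points; the rank of a point in $\pi$ is its priority. Add two points $p_{-\infty}=(-\infty,-\infty)$ and $p_{\infty}=(\infty,-\infty)$, so that the lines joining them to other points are vertical downward rays, with priorities $-1$ and $0$. At a time $t$, order the points by $x$-coordinate (lexicographically in case of ties). The pseudo-triangulation at time $t$ is defined recursively: start with $Q$ equal to the whole augmented set; given a set $Q$ of consecutive points with leftmost point $a$ and rightmost point $c$ and at least one other point, let $b$ be the point of minimum priority of $Q\setminus\{a,c\}$, output the pseudo-triangle with left endpoint $a$, apex $b$ and right endpoint $c$, and recurse on the set $Q_L$ of points of $Q$ from $a$ to $b$ and on the set $Q_R$ of points of $Q$ from $b$ to $c$. The *bridge* of the pseudo-triangle is the part of the upper common tangent of the upper hulls of $Q_L$ and $Q_R$ between the points of tangency, provided that $b$ lies strictly below it (otherwise the *funnel* is empty). The left chain $\mathcal L$ is the part of the upper hull of $Q_L$ from the left end of the bridge to $b$, the right chain $\mathcal R$ is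 the part of the upper hull of $Q_R$ from $b$ to the right end of the bridge, and the funnel is the polygon bounded by the bridge, $\mathcal L$ and $\mathcal R$; if it is empty, both chains consist of $b$ alone. Vertices $p\ne b$ of $\mathcal L$ and $q\ne b$ of $\mathcal R$ see each other if the segment $pq$ meets the boundary of the funnel only at its endpoints, or if $pq$ is the bridge. For a vertex $p\neq b$ of $\mathcal L$ (resp. $\mathcal R$), $\nu(p)$ is the rightmost vertex of $\mathcal R$ (resp. leftmost vertex of $\mathcal L$) that $p$ sees. A kinetic pseudo-triangle $\tau$ is a triple (left endpoint $a$, apex $b$, right endpoint $c$) together with a maximal connected time interval $I(\tau)$, its lifespan, throughout which the triple is in the pseudo-triangulation. Let $P_\tau$ be the set of points other than the apex that lie strictly between the two endpoints in the $x$-order at some time of $I(\tau)$, and let $N_\tau=|P_\tau|$. A swap event of $\tau$ is a time at which some point crosses the vertical line through an endpoint or the apex of $\tau$. Let $V_\tau$ be the number of visibility events of $\tau$, that is, of changes of $\nu(q)$ for a vertex $q$ of the funnel, and of creations or destructions of the bridge, at times in the interior of $I(\tau)$ that are not swap events. Let $E_\tau$ be the number of envelope events of $\tau$, at which a point that is not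 an endpoint of the bridge joins or leaves $\mathcal L$ or $\mathcal R$, again at times in the interior of $I(\tau)$ that are not swap events. Let $\lambda_m(q)$ be the maximum length of a Davenport–Schinzel sequence of order $m$ on $q$ symbols, and $\beta_m(q)=\lambda_m(q)/q$. **Theorem.** For all $k$ and $s$ there is a constant $C$, depending only on $k$ and $s$, such that for all $n$, all such motions of $n$ points, all permutations $\pi$ and every kinetic pseudo-triangle $\tau$ with $N_\tau\ge 1$, both $V_\tau$ and $E_\tau$ are finite and $$V_\tau\le C\,N_\tau^2\,\beta_{s+2}(N_\tau),\qquad E_\tau\le C\,N_\tau^2\,\beta_{s+2}(N_\tau).$$ -/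

import Mathlib

open Filter Topology

namespace KineticTriangulation

/-! ### Davenport–Schinzel sequences -/

/-- The alternation `a b a b …` of length `m`. -/
def alternation {α : Type*} (a b : α) (m : ℕ) : List α :=
  (List.range m).map fun i => if Even i then a else b

/-- Davenport–Schinzel sequences of order `m`: no two adjacent entries are equal, and no two
distinct symbols alternate `m + 2` times in a (not necessarily contiguous) subsequence. -/
def IsDavenportSchinzel {α : Type*} (m : ℕ) (l : List α) : Prop :=
  l.IsChain (· ≠ ·) ∧ ∀ a b : α, a ≠ b → ¬ (alternation a b (m + 2)).Sublist l

/-- `λ_m(q)`: the maximum length of a Davenport–Schinzel sequence of order `m` on `q` symbols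
(the set of lengths is nonempty and bounded, so this is a true maximum). -/
noncomputable def lam (m q : ℕ) : ℕ :=
  sSup {N | ∃ l : List (Fin q), IsDavenportSchinzel m l ∧ l.length = N}

/-- `β_m(q) = λ_m(q) / q`. -/
noncomputable def beta (m q : ℕ) : ℝ := (lam m q : ℝ) / q

/-! ### The static structure, for a planar configuration `z` of `n` points

The point `p_{-∞} = (-∞, -∞)` is `⊥ : WithBot (Fin n)` (it can only be a left endpoint) and
`p_∞ = (∞, -∞)` is `⊤ : WithTop (Fin n)` (it can only be a right endpoint). -/

section Static

variable {n : ℕ} (z : Fin n → ℝ × ℝ)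

/-- The `x`-order of the points (lexicographic, to break ties). -/
def Precedes (p q : Fin n) : Prop :=
  (z p).1 < (z q).1 ∨ ((z p).1 = (z q).1 ∧ (z p).2 < (z q).2)

/-- The left endpoint `a` (possibly `p_{-∞}`) strictly precedes `p`. -/
def After (a : WithBot (Fin n)) (p : Fin n) : Prop :=
  ∀ i : Fin n, a = (i : WithBot (Fin n)) → Precedes z i p

/-- `p` strictly precedes the right endpoint `c` (possibly `p_∞`). -/
def Before (p : Fin n) (c : WithTop (Fin n)) : Prop :=
  ∀ i : Fin n, c = (i : WithTop (Fin n)) → Precedes z p i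

/-- `p` lies on the chain `C(P)` strictly between `a` and `c`. -/
def Between (a : WithBot (Fin n)) (c : WithTop (Fin n)) (p : Fin n) : Prop :=
  After z a p ∧ Before z p c

/-- Twice the signed area of the triangle `p q r` (positive iff counterclockwise). For `p`
preceding `r`, the point `q` lies above (below) the line `p r` iff `orient z p r q` is positive
(negative). -/
def orient (p q r : Fin n) : ℝ :=
  ((z q).1 - (z p).1) * ((z r).2 - (z p).2) - ((z q).2 - (z p).2) * ((z r).1 - (z p).1)

variable (π : Equiv.Perm (Fin n))

/-- `mid(Q)` for the set `Q` of the points from `a` to `c`: the point of minimum priority among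
those strictly between the two endpoints. -/
def IsMid (a : WithBot (Fin n)) (b : Fin n) (c : WithTop (Fin n)) : Prop :=
  Between z a c b ∧ ∀ p, Between z a c p → π b ≤ π p

/-- The sets `Q` that occur in the recursive construction, each given by its endpoints `left(Q)`
and `right(Q)`: start from the whole (augmented) set and split at `mid(Q)`. -/
inductive IsRecursionSet : WithBot (Fin n) → WithTop (Fin n) → Prop
  | root : IsRecursionSet ⊥ ⊤
  | splitLeft {a : WithBot (Fin n)} {b : Fin n} {c : WithTop (Fin n)} :
      IsRecursionSet a c → IsMid z π a b c → IsRecursionSet a (b : WithTop (Fin n))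
  | splitRight {a : WithBot (Fin n)} {b : Fin n} {c : WithTop (Fin n)} :
      IsRecursionSet a c → IsMid z π a b c → IsRecursionSet (b : WithBot (Fin n)) c

/-- The pseudo-triangulation contains the pseudo-triangle with left endpoint `a`, apex `b` and
right endpoint `c`. -/
def InPT (a : WithBot (Fin n)) (b : Fin n) (c : WithTop (Fin n)) : Prop :=
  IsRecursionSet z π a c ∧ IsMid z π a b c

/-- The (real) points of `Q_L`: those from the left endpoint `a` to the apex `b`, inclusive. -/
def QL (a : WithBot (Fin n)) (b : Fin n) : Set (Fin n) :=
  {p | (a = (p : WithBot (Fin n)) ∨ After z a p) ∧ (p = b ∨ Precedes z p b)}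

/-- The (real) points of `Q_R`: those from the apex `b` to the right endpoint `c`, inclusive. -/
def QR (b : Fin n) (c : WithTop (Fin n)) : Set (Fin n) :=
  {p | (p = b ∨ Precedes z b p) ∧ (c = (p : WithTop (Fin n)) ∨ Before z p c)}

/-- The vertices of the upper hull of `S`: the points of `S` that lie strictly above every segment
that joins a point of `S` to their left with a point of `S` to their right. (The lines from a real
point to `p_{±∞}` are vertical downward rays, so segments that end at `p_{±∞}` never pass above a
real point, and only the real points matter here.) -/
def upperHull (S : Set (Fin n)) : Set (Fin n) :=
  {v | v ∈ S ∧ ∀ p ∈ S, ∀ r ∈ S, Precedes z p v → Precedes z v r → 0 < orient z p r v}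

variable (a : WithBot (Fin n)) (b : Fin n) (c : WithTop (Fin n))

/-- `u v` is the bridge of the pseudo-triangle `(a, b, c)`: the upper common tangent of the hulls
of `Q_L` and `Q_R`, touching them at `u` and `v`, with the apex strictly below it. If the apex is
a vertex of the upper hull of `Q_L ∪ Q_R` then there is no bridge and the funnel is empty. -/
def IsBridge (u v : Fin n) : Prop :=
  u ∈ upperHull z (QL z a b) ∧ v ∈ upperHull z (QR z b c) ∧ Precedes z u v ∧
    (∀ w ∈ QL z a b ∪ QR z b c, orient z u v w ≤ 0) ∧ orient z u v b < 0

/-- The funnel is empty. -/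
def FunnelEmpty : Prop := ¬ ∃ u v, IsBridge z a b c u v

/-- `p` is an endpoint of the bridge. -/
def IsBridgeEndpoint (p : Fin n) : Prop :=
  ∃ u v, IsBridge z a b c u v ∧ (p = u ∨ p = v)

/-- The vertices of the left chain of the funnel: those of the upper hull of `Q_L` from the left
endpoint of the bridge to the apex (just the apex if the funnel is empty). -/
def leftChain : Set (Fin n) :=
  {p | p ∈ upperHull z (QL z a b) ∧
    (p = b ∨ ∃ u v, IsBridge z a b c u v ∧ (p = u ∨ Precedes z u p))}

/-- The vertices of the right chain of the funnel. -/
def rightChain : Set (Fin n) :=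
  {p | p ∈ upperHull z (QR z b c) ∧
    (p = b ∨ ∃ u v, IsBridge z a b c u v ∧ (p = v ∨ Precedes z p v))}

/-- The polygonal curve that joins the points of `S` in their `x`-order. -/
def polyline (S : Set (Fin n)) : Set (ℝ × ℝ) :=
  {w | ∃ i ∈ S, ∃ j ∈ S, Precedes z i j ∧ (∀ k ∈ S, ¬ (Precedes z i k ∧ Precedes z k j)) ∧
    w ∈ segment ℝ (z i) (z j)}

/-- The boundary of the funnel. -/
def funnelBoundary : Set (ℝ × ℝ) :=
  polyline z (leftChain z a b c) ∪ polyline z (rightChain z a b c) ∪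
    {w | ∃ u v, IsBridge z a b c u v ∧ w ∈ segment ℝ (z u) (z v)}

/-- The vertices `p` of the left chain and `q` of the right chain, both different from the apex,
are visible from each other: the segment `p q` meets the boundary of the funnel only at its
endpoints. By convention the two endpoints of the bridge are visible from each other. -/
def Visible (p q : Fin n) : Prop :=
  p ∈ leftChain z a b c ∧ p ≠ b ∧ q ∈ rightChain z a b c ∧ q ≠ b ∧
    (IsBridge z a b c p q ∨ Disjoint (openSegment ℝ (z p) (z q)) (funnelBoundary z a b c))

/-- `ν(p) = q`: for `p` on the left chain, `q` is the rightmost vertex of the right chain visible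
from `p`; for `p` on the right chain, `q` is the leftmost vertex of the left chain visible
from `p`. -/
def IsNu (p q : Fin n) : Prop :=
  (Visible z a b c p q ∧ ∀ q', Visible z a b c p q' → q' = q ∨ Precedes z q' q) ∨
  (Visible z a b c q p ∧ ∀ q', Visible z a b c q' p → q' = q ∨ Precedes z q q')

end Static

/-! ### The kinetic structure -/

section Kinetic

/-- `A` holds right before time `t₀` and `B` holds right after it. -/
def Switches (A B : ℝ → Prop) (t₀ : ℝ) : Prop :=
  (∀ᶠ t in 𝓝[<] t₀, A t) ∧ ∀ᶠ t in 𝓝[>] t₀, B t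

/-- The configuration at time `t`. -/
def conf {n : ℕ} (P : Fin n → ℝ → ℝ × ℝ) (t : ℝ) : Fin n → ℝ × ℝ := fun i => P i t

/-- A pseudo-triangle of the kinetic pseudo-triangulation: its two endpoints and its apex, with a
maximal connected time interval during which it is present. -/
structure PseudoTriangle {n : ℕ} (P : Fin n → ℝ → ℝ × ℝ) (π : Equiv.Perm (Fin n)) where
  left : WithBot (Fin n)
  apex : Fin n
  right : WithTop (Fin n)
  lifespan : Set ℝ
  isLifespan : ∃ t, InPT (conf P t) π left apex right ∧
    lifespan = connectedComponentIn {t' | InPT (conf P t') π left apex right} t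

variable {n : ℕ} {P : Fin n → ℝ → ℝ × ℝ} {π : Equiv.Perm (Fin n)}

namespace PseudoTriangle

variable (τ : PseudoTriangle P π)

/-- `P_τ`: the points other than the apex that lie between the endpoints at some time of the
lifespan. -/
def points : Set (Fin n) :=
  {p | p ≠ τ.apex ∧ ∃ t ∈ τ.lifespan, Between (conf P t) τ.left τ.right p}

/-- `N_τ = |P_τ|`. -/
noncomputable def N : ℕ := τ.points.ncard

/-- `e` is one of the left endpoint, the apex and the right endpoint. -/
def IsCorner (e : Fin n) : Prop :=
  τ.left = (e : WithBot (Fin n)) ∨ e = τ.apex ∨ τ.right = (e : WithTop (Fin n))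

/-- Swap events: some point crosses the vertical line through an endpoint or the apex. -/
def IsSwap (t₀ : ℝ) : Prop :=
  ∃ p e, τ.IsCorner e ∧
    (Switches (fun t => Precedes (conf P t) p e) (fun t => Precedes (conf P t) e p) t₀ ∨
      Switches (fun t => Precedes (conf P t) e p) (fun t => Precedes (conf P t) p e) t₀)

/-- The times of the lifespan at which no swap event occurs (at the two ends of the lifespan the
pseudo-triangle itself is created or destroyed by a swap). -/
def regularTimes : Set ℝ := {t | t ∈ interior τ.lifespan ∧ ¬ τ.IsSwap t}

/-- `ν(q)` changes at time `t₀`. -/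
def NuChanges (q : Fin n) (t₀ : ℝ) : Prop :=
  ∃ p r, p ≠ r ∧
    Switches (fun t => IsNu (conf P t) τ.left τ.apex τ.right q p)
      (fun t => IsNu (conf P t) τ.left τ.apex τ.right q r) t₀

/-- The bridge is created or destroyed at time `t₀`. -/
def BridgeAppearsOrVanishes (t₀ : ℝ) : Prop :=
  Switches (fun t => FunnelEmpty (conf P t) τ.left τ.apex τ.right)
    (fun t => ¬ FunnelEmpty (conf P t) τ.left τ.apex τ.right) t₀ ∨
  Switches (fun t => ¬ FunnelEmpty (conf P t) τ.left τ.apex τ.right)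
    (fun t => FunnelEmpty (conf P t) τ.left τ.apex τ.right) t₀

/-- The visibility events, each given by its time and the involved vertex `q`, whose `ν(q)`
changes; an event that creates or destroys the bridge is recorded with `none`. -/
def visibilityEvents : Set (ℝ × Option (Fin n)) :=
  {e | e.1 ∈ τ.regularTimes ∧
    ((∃ q, e.2 = some q ∧ τ.NuChanges q e.1) ∨ (e.2 = none ∧ τ.BridgeAppearsOrVanishes e.1))}

/-- At time `t₀` the point `p` joins or leaves the chain `C` as a vertex that is not an endpoint
of the bridge. -/
def JoinsOrLeaves (C : ℝ → Set (Fin n)) (p : Fin n) (t₀ : ℝ) : Prop :=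
  Switches (fun t => p ∉ C t)
    (fun t => p ∈ C t ∧ ¬ IsBridgeEndpoint (conf P t) τ.left τ.apex τ.right p) t₀ ∨
  Switches (fun t => p ∈ C t ∧ ¬ IsBridgeEndpoint (conf P t) τ.left τ.apex τ.right p)
    (fun t => p ∉ C t) t₀

/-- The envelope events, each given by its time and the involved vertex. -/
def envelopeEvents : Set (ℝ × Fin n) :=
  {e | e.1 ∈ τ.regularTimes ∧
    (τ.JoinsOrLeaves (fun t => leftChain (conf P t) τ.left τ.apex τ.right) e.2 e.1 ∨
      τ.JoinsOrLeaves (fun t => rightChain (conf P t) τ.left τ.apex τ.right) e.2 e.1)}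

/-- `V_τ`. -/
noncomputable def V : ℕ := τ.visibilityEvents.ncard

/-- `E_τ`. -/
noncomputable def E : ℕ := τ.envelopeEvents.ncard

end PseudoTriangle

/-- Continuous pseudo-algebraic motion: every two points have the same `x`-coordinate at most
`k` times, and every three points are collinear at most `s` times. -/
structure IsPseudoAlgebraic (k s : ℕ) (P : Fin n → ℝ → ℝ × ℝ) : Prop where
  continuous : ∀ i, Continuous (P i)
  swaps : ∀ i j, i ≠ j → {t | (P i t).1 = (P j t).1}.encard ≤ k
  collinear : ∀ i j l, i ≠ j → j ≠ l → i ≠ l →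
    {t | Collinear ℝ ({P i t, P j t, P l t} : Set (ℝ × ℝ))}.encard ≤ s

end Kinetic

end KineticTriangulation

namespace KineticTriangulation

/-! ### Davenport–Schinzel sequences -/

section DavenportSchinzel

/-! Fix a vertex `q`, say of the left chain. The rightmost vertex that it sees is the point of
tangency from `q` to the hull of `Q_R`, that is, the point of `Q_R` whose connection to `q` has the
largest slope (`slopeOf_le_of_rightmost_visible`; the right chain follows by reflection). So `ν(q)`
follows an upper envelope of slopes, regarded as functions of time. Two such slopes agree only when
three points are collinear, at most `s` times. A point enters or leaves the domain of the envelope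
only when it crosses `q` or a corner, at most `4 * k` times. Cutting each slope function at these
crossings leaves pieces defined on intervals, and the envelope becomes a Davenport–Schinzel sequence
of order `s + 2` on `O(N)` symbols. Hence each `q` contributes `O(λ_{s+2}(N))` changes
(`encard_breaks_slopeEnvelope_le`, `exists_lam_mul_le`).

All other events are changes of hull membership. In general position the bridge is missing exactly
when the apex is on the hull of `Q_L ∪ Q_R` (`funnelEmpty_iff`). A chain vertex other than the apex
and the bridge endpoints is on the hull of its own side but not on that of the union, and every
non-apex point with this property is on the chain. A point is on a hull iff its least slope to the
left exceeds its greatest slope to the right. While both extremal points stay fixed, this is the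
orientation of one triple, which changes sign at most `s` times. So each point again contributes
`O(λ_{s+2}(N))` changes (`encard_breaks_upperHull_le`).

Summing over the at most `N + 3` vertices gives `O(N λ_{s+2}(N)) = O(N² β_{s+2}(N))`. Only finitely
many times are degenerate, so everything is compared on punctured neighbourhoods, where the
configuration is in general position. -/

lemma alternation_map {α β : Type*} (f : α → β) (a b : α) (m : ℕ) :
    (alternation a b m).map f = alternation (f a) (f b) m := by
  simp only [alternation, List.map_map]
  refine List.map_congr_left fun i _ => ?_
  simp only [Function.comp]
  split_ifs <;> rfl

lemma alternation_succ {α : Type*} (a b : α) (m : ℕ) :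
    alternation a b (m + 1) = a :: alternation b a m := by
  simp only [alternation, List.range_succ_eq_map, List.map_cons, List.map_map]
  congr 1
  refine List.map_congr_left fun i _ => ?_
  by_cases h : Even i <;> simp [Nat.even_add_one, h]

@[simp] lemma length_alternation {α : Type*} (a b : α) (m : ℕ) :
    (alternation a b m).length = m := by
  simp [alternation]

lemma alternation_sublist_of_le {α : Type*} (a b : α) {m m' : ℕ} (h : m ≤ m') :
    (alternation a b m).Sublist (alternation a b m') := by
  unfold alternation
  refine List.Sublist.map _ ?_
  exact (List.range_sublist).2 h

/-- A list without adjacent repetitions on two symbols is an alternation. -/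
lemma eq_alternation_of_isChain {α : Type*} {a b : α} (l : List α)
    (hc : l.IsChain (· ≠ ·)) (hl : ∀ x ∈ l, x = a ∨ x = b) :
    l = alternation a b l.length ∨ l = alternation b a l.length := by
  induction l with
  | nil => left; simp [alternation]
  | cons x l ih =>
    have ih' := ih hc.tail (fun y hy => hl y (List.mem_cons_of_mem _ hy))
    have key : ∀ c d : α, x = c → (∀ y ∈ l, y = c ∨ y = d) →
        (l = alternation c d l.length ∨ l = alternation d c l.length) →
        x :: l = alternation c d (x :: l).length := by
      intro c d hx hd h
      rw [List.length_cons, alternation_succ, hx]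
      congr 1
      rcases h with h | h
      · cases l with
        | nil => simp [alternation]
        | cons y l =>
          rw [List.length_cons, alternation_succ] at h
          have h1 : y = c := (List.cons.inj h).1
          have h2 := List.isChain_cons_cons.1 hc
          exact absurd (hx.trans h1.symm) h2.1
      · exact h
    have hl' : ∀ y ∈ l, y = a ∨ y = b := fun y hy => hl y (List.mem_cons_of_mem _ hy)
    rcases hl x List.mem_cons_self with hx | hx
    · exact Or.inl (key a b hx hl' ih')
    · exact Or.inr (key b a hx (fun y hy => (hl' y hy).symm) ih'.symm)

/-- With only two symbols available, distinct neighbours force the whole list to be an alternation,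
so the order caps its length directly. -/
lemma IsDavenportSchinzel.length_le_of_two_symbols {α : Type*} {m : ℕ} {l : List α}
    (h : IsDavenportSchinzel m l) {a b : α} (hl : ∀ x ∈ l, x = a ∨ x = b) :
    l.length ≤ m + 2 := by
  by_cases hab : a = b
  · subst hab
    cases l with
    | nil => simp
    | cons x l =>
      cases l with
      | nil => simp
      | cons y l =>
        have h1 := (List.isChain_cons_cons.1 h.1).1
        have hx := hl x (by simp)
        have hy := hl y (by simp)
        simp only [or_self] at hx hy
        exact absurd (hx.trans hy.symm) h1
  · by_contra hlt
    push Not at hlt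
    rcases eq_alternation_of_isChain l h.1 hl with h1 | h1
    · refine h.2 a b hab ?_
      rw [h1]
      exact alternation_sublist_of_le _ _ hlt.le
    · refine h.2 b a (Ne.symm hab) ?_
      rw [h1]
      exact alternation_sublist_of_le _ _ hlt.le

lemma IsDavenportSchinzel.of_sublist {α : Type*} {m : ℕ} {l l' : List α}
    (h : IsDavenportSchinzel m l) (hs : l'.Sublist l) (hc : l'.IsChain (· ≠ ·)) :
    IsDavenportSchinzel m l' :=
  ⟨hc, fun a b hab hsub => h.2 a b hab (hsub.trans hs)⟩

/-- Restricting a list without adjacent repetitions to a set of symbols and removing the adjacent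
repetitions keeps at least as many entries as there were adjacent pairs inside the set. -/
lemma exists_sublist_of_adjacent_pairs {α : Type*} (W : α → Prop) [DecidablePred W] (l : List α)
    (hc : l.IsChain (· ≠ ·)) :
    ∃ l' : List α, l'.Sublist l ∧ l'.IsChain (· ≠ ·) ∧ (∀ x ∈ l', W x) ∧
      (∀ x, l.head? = some x → W x → l'.head? = some x) ∧
      (l.zip l.tail).countP (fun p => decide (W p.1 ∧ W p.2)) ≤ l'.length := by
  classical
  induction l with
  | nil => exact ⟨[], by simp⟩
  | cons x l ih =>
    obtain ⟨l', h1, h2, h3, h4, h5⟩ := ih hc.tail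
    by_cases hx : W x
    -- The clause about heads is what makes the induction run: if `l'` already starts with `x`, then
    -- the entry of `l` after `x` lies outside `W`, so no new pair is counted and `x` need not be
    -- added.
    · by_cases hhead : l'.head? = some x
      · refine ⟨l', h1.cons _, h2, h3, fun y hy _ => ?_, ?_⟩
        · simpa using hhead.trans (by simpa using hy)
        cases l with
        | nil => simp
        | cons y l =>
          have hxy : x ≠ y := (List.isChain_cons_cons.1 hc).1
          have hy : ¬ W y := by
            intro hy
            have := h4 y rfl hy
            rw [hhead] at this
            exact hxy (Option.some.inj this)
          simpa [List.countP_cons, hy] using h5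
      · refine ⟨x :: l', h1.cons_cons _, ?_, ?_, ?_, ?_⟩
        · rw [List.isChain_cons]
          refine ⟨fun y hy hxy => hhead ?_, h2⟩
          rw [hxy]; exact hy
        · intro y hy
          rcases List.mem_cons.1 hy with rfl | hy
          · exact hx
          · exact h3 y hy
        · intro y hy _
          simpa using hy
        · cases l with
          | nil => simp
          | cons y l =>
            simp only [List.tail_cons, List.zip_cons_cons, List.countP_cons,
              List.length_cons] at h5 ⊢
            refine Nat.add_le_add h5 ?_
            split_ifs <;> simp
    · refine ⟨l', h1.cons _, h2, h3, ?_, ?_⟩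
      · intro y hy hWy
        simp only [List.head?_cons, Option.some.injEq] at hy
        exact absurd (hy ▸ hWy) hx
      · cases l with
        | nil => simp
        | cons y l => simpa [List.countP_cons, hx] using h5

lemma length_le_sum_countP {α ι : Type*} [DecidableEq ι] (T : Finset ι) (f : α → ι)
    (l : List α) (hl : ∀ x ∈ l, f x ∈ T) :
    l.length ≤ ∑ c ∈ T, l.countP (fun x => decide (f x = c)) := by
  induction l with
  | nil => simp
  | cons x l ih =>
    simp only [List.countP_cons, Finset.sum_add_distrib, List.length_cons]
    refine Nat.add_le_add (ih fun y hy => hl y (List.mem_cons_of_mem _ hy)) ?_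
    simp [hl x List.mem_cons_self]

/-- If all Davenport–Schinzel sequences on the union of two classes of symbols have length at most
`M`, then all such sequences have length at most `1 + G ^ 2 * M`, where `G` is the number of
classes. -/
lemma IsDavenportSchinzel.length_le_of_classes {α : Type*} {m : ℕ} {l : List α}
    (h : IsDavenportSchinzel m l) (G M : ℕ) (γ : α → Fin G)
    (hM : ∀ i j, ∀ l' : List α, IsDavenportSchinzel m l' →
      (∀ x ∈ l', γ x = i ∨ γ x = j) → l'.length ≤ M) :
    l.length ≤ 1 + G ^ 2 * M := by
  classical
  -- Sort the `l.length - 1` adjacent pairs by their pair of classes. Those of type `(i, j)` survive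
  -- in the restriction of `l` to the classes `i` and `j`, so there are at most `M` of each type.
  have h1 := length_le_sum_countP (Finset.univ : Finset (Fin G × Fin G))
    (fun p : α × α => (γ p.1, γ p.2)) (l.zip l.tail) (by simp)
  have h2 : ∀ c ∈ (Finset.univ : Finset (Fin G × Fin G)),
      (l.zip l.tail).countP (fun x => decide ((γ x.1, γ x.2) = c)) ≤ M := by
    rintro ⟨i, j⟩ -
    obtain ⟨l', hs, hc, hW, -, hle⟩ :=
      exists_sublist_of_adjacent_pairs (fun x => γ x = i ∨ γ x = j) l h.1
    refine le_trans (le_trans (List.countP_mono_left ?_) hle) (hM i j l' (h.of_sublist hs hc) hW)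
    intro p _ hp
    simp only [Prod.mk.injEq, decide_eq_true_eq] at hp ⊢
    exact ⟨Or.inl hp.1, Or.inr hp.2⟩
  have h3 := h1.trans (Finset.sum_le_sum h2)
  simp only [List.length_zip, List.length_tail, Finset.sum_const, Finset.card_univ,
    Fintype.card_prod, Fintype.card_fin, smul_eq_mul] at h3
  have h4 : min l.length (l.length - 1) = l.length - 1 := by omega
  rw [h4] at h3
  have h5 : G * G * M = G ^ 2 * M := by ring
  omega

/-- Taking every symbol as its own class reduces boundedness to lists on two symbols; without
boundedness `sSup` in `lam` would be a junk value. -/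
lemma bddAbove_lengths (m q : ℕ) :
    BddAbove {N | ∃ l : List (Fin q), IsDavenportSchinzel m l ∧ l.length = N} := by
  refine ⟨1 + q ^ 2 * (m + 2), ?_⟩
  rintro N ⟨l, hl, rfl⟩
  exact hl.length_le_of_classes q (m + 2) id
    (fun i j l' hl' h => hl'.length_le_of_two_symbols h)

lemma IsDavenportSchinzel.length_le_lam {m q : ℕ} {l : List (Fin q)}
    (h : IsDavenportSchinzel m l) : l.length ≤ lam m q :=
  le_csSup (bddAbove_lengths m q) ⟨l, h, rfl⟩

lemma lam_le {m q B : ℕ} (h : ∀ l : List (Fin q), IsDavenportSchinzel m l → l.length ≤ B) :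
    lam m q ≤ B := by
  refine csSup_le ⟨0, [], ⟨by simp, fun a b _ hs => ?_⟩, rfl⟩ ?_
  · have := hs.length_le
    simp at this
  · rintro N ⟨l, hl, rfl⟩
    exact h l hl

lemma one_le_lam (m : ℕ) {q : ℕ} (hq : 0 < q) : 1 ≤ lam m q := by
  have : IsDavenportSchinzel m [(⟨0, hq⟩ : Fin q)] := by
    refine ⟨by simp, fun a b _ hs => ?_⟩
    have := hs.length_le
    simp at this
  simpa using this.length_le_lam

/-- The symbols of `W` are renamed by elements of `Fin q`; a left inverse of the renaming carries a
forbidden alternation back to `l`. Its value outside the image, `x₀`, is irrelevant. -/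
lemma IsDavenportSchinzel.length_le_lam_of_forall_mem {α : Type*} {m q : ℕ} {l : List α}
    (h : IsDavenportSchinzel m l) (W : Finset α) (hW : ∀ x ∈ l, x ∈ W) (hq : W.card ≤ q) :
    l.length ≤ lam m q := by
  classical
  cases hl : l with
  | nil => simp
  | cons x₀ l₀ =>
  rw [← hl]
  have hx₀ : x₀ ∈ W := hW x₀ (by simp [hl])
  let e := W.equivFin
  have hpos : 0 < q := (Finset.card_pos.2 ⟨x₀, hx₀⟩).trans_le hq
  let f : α → Fin q := fun x => if hx : x ∈ W then Fin.castLE hq (e ⟨x, hx⟩) else ⟨0, hpos⟩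
  let g : Fin q → α := fun i => if hi : i.1 < W.card then (e.symm ⟨i.1, hi⟩).1 else x₀
  have hgf : ∀ x ∈ W, g (f x) = x := by
    intro x hx
    have : f x = Fin.castLE hq (e ⟨x, hx⟩) := by simp [f, hx]
    rw [this]
    simp [g]
  have hmap : (l.map f).map g = l := by
    rw [List.map_map]
    conv_rhs => rw [← List.map_id l]
    exact List.map_congr_left fun x hx => hgf x (hW x hx)
  have hds : IsDavenportSchinzel m (l.map f) := by
    constructor
    · rw [List.isChain_map]
      refine (List.isChain_iff_forall_rel_of_append_cons_cons).2 ?_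
      intro a b l₁ l₂ hl' hab
      have hne := (List.isChain_iff_forall_rel_of_append_cons_cons).1 h.1 hl'
      have ha : a ∈ W := hW a (by simp [hl'])
      have hb : b ∈ W := hW b (by simp [hl'])
      exact hne (by rw [← hgf a ha, ← hgf b hb, hab])
    · intro a b hab hs
      have hs' := hs.map g
      rw [alternation_map, hmap] at hs'
      refine h.2 (g a) (g b) (fun hg => hab ?_) hs'
      have ha : a ∈ alternation a b (m + 2) := by
        rw [alternation_succ]; simp
      have hb : b ∈ alternation a b (m + 2) := by
        rw [alternation_succ, alternation_succ]; simp
      obtain ⟨a', ha', rfl⟩ := List.mem_map.1 (hs.subset ha)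
      obtain ⟨b', hb', rfl⟩ := List.mem_map.1 (hs.subset hb)
      rw [hgf _ (hW _ ha'), hgf _ (hW _ hb')] at hg
      rw [hg]
  simpa using hds.length_le_lam

lemma lam_mono (m : ℕ) {q q' : ℕ} (h : q ≤ q') : lam m q ≤ lam m q' :=
  lam_le fun l hl => hl.length_le_lam_of_forall_mem Finset.univ (by simp) (by simpa using h)

/-- Multiplying the number of symbols by a constant multiplies `λ_m` by at most a constant. -/
lemma exists_lam_mul_le (m K : ℕ) :
    ∃ C : ℕ, ∀ N, 0 < N → lam m (K * N) ≤ C * lam m N := by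
  refine ⟨lam m K + (1 + (3 * K + 1) ^ 2), fun N hN => ?_⟩
  have h1 := one_le_lam m hN
  -- The blocks used below have `N / 2` symbols, which is positive only for `N ≥ 2`.
  rcases Nat.lt_or_ge N 2 with h2 | h2
  · obtain rfl : N = 1 := by omega
    rw [Nat.mul_one]
    nlinarith [Nat.zero_le (lam m K), Nat.zero_le (1 + (3 * K + 1) ^ 2)]
  · have hmain : lam m (K * N) ≤ 1 + (3 * K + 1) ^ 2 * lam m N := by
      refine lam_le fun l hl => ?_
      have hh : 0 < N / 2 := by omega
      -- The classes are blocks of `N / 2` consecutive symbols, so that two of them hold at most `N`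
      -- symbols together; `N ≤ 3 * (N / 2)` bounds their number.
      have hγ : ∀ x : Fin (K * N), x.1 / (N / 2) < 3 * K + 1 := by
        intro x
        rw [Nat.div_lt_iff_lt_mul hh]
        have h3 : N ≤ 3 * (N / 2) := by omega
        calc x.1 < K * N := x.2
          _ ≤ K * (3 * (N / 2)) := Nat.mul_le_mul_left _ h3
          _ ≤ (3 * K + 1) * (N / 2) := by nlinarith
      refine hl.length_le_of_classes (3 * K + 1) (lam m N) (fun x => ⟨x.1 / (N / 2), hγ x⟩) ?_
      intro i j l' hl' hW
      refine hl'.length_le_lam_of_forall_mem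
        (Finset.univ.filter fun x : Fin (K * N) => x.1 / (N / 2) = i.1 ∨ x.1 / (N / 2) = j.1)
        (fun x hx => ?_) ?_
      · simpa [Fin.ext_iff] using hW x hx
      · have hcls : ∀ c : ℕ,
            (Finset.univ.filter fun x : Fin (K * N) => x.1 / (N / 2) = c).card ≤ N / 2 := by
          intro c
          have := Finset.card_le_card_of_injOn (s := Finset.univ.filter
            fun x : Fin (K * N) => x.1 / (N / 2) = c)
            (t := Finset.Ico (c * (N / 2)) (c * (N / 2) + N / 2)) (fun x => x.1) ?_ ?_
          · simpa using this
          · intro x hx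
            have hx' : x.1 / (N / 2) = c := by simpa using hx
            have h4 := Nat.div_add_mod x.1 (N / 2)
            have h5 := Nat.mod_lt x.1 hh
            rw [hx', Nat.mul_comm] at h4
            simp only [Finset.coe_Ico, Set.mem_Ico]
            omega
          · intro x _ y _ hxy
            exact Fin.ext hxy
        rw [Finset.filter_or]
        refine (Finset.card_union_le _ _).trans ?_
        have := hcls i.1
        have := hcls j.1
        omega
    nlinarith [Nat.zero_le (lam m K * lam m N)]

end DavenportSchinzel

/-! ### Break points of functions of time -/

section Breaks

variable {α β γ : Type*}

/-- The times around which `g` is not constant (its value at the time itself is disregarded). -/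
def breaks (g : ℝ → α) : Set ℝ := {t₀ | ¬ ∃ c, ∀ᶠ t in 𝓝[≠] t₀, g t = c}

lemma breaks_comp_subset (f : α → β) (g : ℝ → α) : breaks (fun t => f (g t)) ⊆ breaks g := by
  rintro t₀ ht ⟨c, hc⟩
  exact ht ⟨f c, hc.mono fun t h => congrArg f h⟩

lemma breaks_comp₂_subset (f : α → β → γ) (g : ℝ → α) (h : ℝ → β) :
    breaks (fun t => f (g t) (h t)) ⊆ breaks g ∪ breaks h := by
  intro t₀ ht
  by_contra hn
  simp only [Set.mem_union, not_or, breaks, Set.mem_ofPred_eq, not_not] at hn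
  obtain ⟨⟨c, hc⟩, ⟨d, hd⟩⟩ := hn
  exact ht ⟨f c d, by filter_upwards [hc, hd] with t h1 h2; rw [h1, h2]⟩

lemma mem_breaks_of_eventually {g : ℝ → α} {t₀ : ℝ} {x y : α} (hxy : x ≠ y)
    (h₁ : ∀ᶠ t in 𝓝[<] t₀, g t = x) (h₂ : ∀ᶠ t in 𝓝[>] t₀, g t = y) : t₀ ∈ breaks g := by
  rintro ⟨c, hc⟩
  have hl : ∀ᶠ t in 𝓝[<] t₀, g t = c :=
    hc.filter_mono (nhdsWithin_mono _ fun t (ht : t < t₀) => ht.ne)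
  have hr : ∀ᶠ t in 𝓝[>] t₀, g t = c :=
    hc.filter_mono (nhdsWithin_mono _ fun t (ht : t₀ < t) => ht.ne')
  obtain ⟨t, h, h'⟩ := (h₁.and hl).exists
  obtain ⟨t', k, k'⟩ := (h₂.and hr).exists
  exact hxy (by rw [← h, h', ← k', k])

lemma mem_breaks_of_eventuallyEq {g h : ℝ → α} {t₀ : ℝ} (ht : t₀ ∈ breaks g)
    (hgh : ∀ᶠ t in 𝓝[≠] t₀, g t = h t) : t₀ ∈ breaks h := by
  rintro ⟨c, hc⟩
  exact ht ⟨c, by filter_upwards [hc, hgh] with t h1 h2; rw [h2, h1]⟩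

lemma exists_ne_of_mem_breaks {g : ℝ → α} {t₀ : ℝ} (ht : t₀ ∈ breaks g) {U : Set ℝ}
    (hU : U ∈ 𝓝[≠] t₀) : ∃ t ∈ U, ∃ t' ∈ U, t < t₀ ∧ t₀ < t' ∧ g t ≠ g t' := by
  by_contra hn
  push Not at hn
  have hl : U ∈ 𝓝[<] t₀ := nhdsWithin_mono _ (fun t (ht : t < t₀) => ht.ne) hU
  have hr : U ∈ 𝓝[>] t₀ := nhdsWithin_mono _ (fun t (ht : t₀ < t) => ht.ne') hU
  obtain ⟨t₁, h₁, h₁'⟩ := (Filter.Eventually.and hl (self_mem_nhdsWithin)).exists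
  obtain ⟨t₂, h₂, h₂'⟩ := (Filter.Eventually.and hr (self_mem_nhdsWithin)).exists
  refine ht ⟨g t₁, ?_⟩
  filter_upwards [hU, self_mem_nhdsWithin] with t ht htne
  rcases lt_or_gt_of_ne htne with h | h
  · rw [hn t ht t₂ h₂ h h₂', hn t₁ h₁ t₂ h₂ h₁' h₂']
  · rw [hn t₁ h₁ t ht h₁' h]

lemma mem_nhdsNE_of_finite_compl {G : Set ℝ} (hG : Gᶜ.Finite) (t₀ : ℝ) : G ∈ 𝓝[≠] t₀ := by
  have h : (Gᶜ \ {t₀})ᶜ ∈ 𝓝 t₀ :=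
    (hG.subset Set.sdiff_subset).isClosed.isOpen_compl.mem_nhds (by simp)
  filter_upwards [mem_nhdsWithin_of_mem_nhds h, self_mem_nhdsWithin] with t h1 h2
  by_contra h3
  exact h1 ⟨h3, h2⟩

/-- Counting with `encard` yields finiteness together with the bound, and reduces both to finite
subfamilies. -/
lemma encard_le_of_forall_finset {S : Set α} {K : ℕ}
    (h : ∀ T : Finset α, (T : Set α) ⊆ S → T.card ≤ K) : S.encard ≤ K := by
  by_contra hlt
  push Not at hlt
  obtain ⟨T, hT, hc⟩ := Set.exists_subset_encard_eq
    (show ((K + 1 : ℕ) : ℕ∞) ≤ S.encard by exact_mod_cast Order.add_one_le_of_lt hlt)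
  have hfin : T.Finite := Set.finite_of_encard_eq_coe hc
  have h1 := h hfin.toFinset (by simpa using hT)
  have h2 : (hfin.toFinset.card : ℕ∞) = ((K + 1 : ℕ) : ℕ∞) := by
    rw [← hc, hfin.encard_eq_coe_toFinset_card]
  have h3 : hfin.toFinset.card = K + 1 := by exact_mod_cast h2
  omega

/-- Sampling a function around `T.card` break points yields a sequence of `T.card` values without
adjacent repetitions. -/
lemma exists_samples (g : ℝ → α) {U : Set ℝ} (T : Finset ℝ)
    (hT : ∀ t₀ ∈ T, t₀ ∈ breaks g ∧ U ∈ 𝓝[≠] t₀) :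
    ∀ B : ℝ, (∀ t₀ ∈ T, B < t₀) → ∃ w : List ℝ, w.length = T.card ∧ (∀ t ∈ w, B < t ∧ t ∈ U) ∧
      w.Pairwise (· < ·) ∧ (w.map g).IsChain (· ≠ ·) := by
  classical
  induction T using Finset.induction_on_min with
  | empty => exact fun B _ => ⟨[], by simp⟩
  | insert a T haT ih =>
    intro B hB
    have ih' := ih fun t₀ h => hT t₀ (Finset.mem_insert_of_mem h)
    obtain ⟨B', hB', hBT⟩ : ∃ B', a < B' ∧ ∀ t₀ ∈ T, B' < t₀ := by
      rcases T.eq_empty_or_nonempty with rfl | hne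
      · exact ⟨a + 1, by simp⟩
      · obtain ⟨B', h1, h2⟩ := exists_between (haT _ (T.min'_mem hne))
        exact ⟨B', h1, fun t₀ ht => h2.trans_le (T.min'_le _ ht)⟩
    obtain ⟨w, hlen, hw, hsort, hchain⟩ := ih' B' hBT
    have haB : B < a := hB a (Finset.mem_insert_self _ _)
    have ha := hT a (Finset.mem_insert_self _ _)
    have hU : U ∩ Set.Ioo B B' ∈ 𝓝[≠] a :=
      inter_mem ha.2 (mem_nhdsWithin_of_mem_nhds (Ioo_mem_nhds haB hB'))
    obtain ⟨t, ht, t', ht', -, -, hne⟩ := exists_ne_of_mem_breaks ha.1 hU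
    -- Near a break point `g` takes two different values, and at least one of them differs from the
    -- value at the next sample. The bound `B'` keeps the new sample before the later ones.
    obtain ⟨r, hr, hrw⟩ : ∃ r ∈ U ∩ Set.Ioo B B', ∀ y ∈ (w.map g).head?, g r ≠ y := by
      cases hh : (w.map g).head? with
      | none => exact ⟨t, ht, by simp⟩
      | some y =>
        by_cases hty : g t = y
        · exact ⟨t', ht', by simpa using fun h => hne (hty.trans h.symm)⟩
        · exact ⟨t, ht, by simpa using hty⟩
    refine ⟨r :: w, ?_, ?_, ?_, ?_⟩
    · rw [List.length_cons, hlen, Finset.card_insert_of_notMem fun h => (haT a h).false]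
    · intro x hx
      rcases List.mem_cons.1 hx with rfl | hx
      · exact ⟨hr.2.1, hr.1⟩
      · exact ⟨(haB.trans hB').trans (hw x hx).1, (hw x hx).2⟩
    · exact List.pairwise_cons.2 ⟨fun x hx => hr.2.2.trans (hw x hx).1, hsort⟩
    · rw [List.map_cons, List.isChain_cons]
      exact ⟨hrw, hchain⟩

/-- A function that attains few values and in which no two values alternate often has few break
points. -/
lemma encard_breaks_le_lam {m M : ℕ} (g : ℝ → α) {J G : Set ℝ} (hG : Gᶜ.Finite) (W : Finset α)
    (hWM : W.card ≤ M) (hW : ∀ t ∈ J ∩ G, g t ∈ W)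
    (halt : ∀ x y, x ≠ y → ∀ σ : Fin (m + 2) → ℝ, StrictMono σ → (∀ i, σ i ∈ J ∩ G) →
      (∀ i, g (σ i) = if Even i.1 then x else y) → False) :
    (breaks g ∩ interior J).encard ≤ lam m M := by
  refine encard_le_of_forall_finset fun T hT => ?_
  have hT' : ∀ t₀ ∈ T, t₀ ∈ breaks g ∧ J ∩ G ∈ 𝓝[≠] t₀ := by
    intro t₀ ht
    exact ⟨(hT ht).1, inter_mem (mem_nhdsWithin_of_mem_nhds
      (mem_interior_iff_mem_nhds.1 (hT ht).2)) (mem_nhdsNE_of_finite_compl hG t₀)⟩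
  obtain ⟨B, hB⟩ : ∃ B, ∀ t₀ ∈ T, B < t₀ := by
    obtain ⟨B, hB⟩ := T.bddBelow
    exact ⟨B - 1, fun t₀ h => by have := hB h; linarith⟩
  obtain ⟨w, hlen, hw, hsort, hchain⟩ := exists_samples g T hT' B hB
  rw [← hlen, ← List.length_map (as := w) g]
  -- An alternation among the sampled values comes from increasing times in `J ∩ G`, which is what
  -- `halt` forbids.
  refine IsDavenportSchinzel.length_le_lam_of_forall_mem ⟨hchain, ?_⟩ W ?_ hWM
  · intro x y hxy hs
    obtain ⟨w', hw', heq⟩ := List.sublist_map_iff.1 hs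
    have hl : w'.length = m + 2 := by
      have := congrArg List.length heq
      simpa using this.symm
    refine halt x y hxy (fun i => w'.get (Fin.cast hl.symm i)) ?_ ?_ ?_
    · intro i j hij
      exact List.pairwise_iff_get.1 (hsort.sublist hw') _ _ hij
    · intro i
      exact (hw _ (hw'.subset (List.get_mem _ _))).2
    · intro i
      have h1 : (w'.map g)[i.1]? = (alternation x y (m + 2))[i.1]? := by rw [heq]
      have h2 : i.1 < w'.length := by rw [hl]; exact i.2
      simpa [alternation, h2, i.2] using h1
  · intro x hx
    obtain ⟨t, ht, rfl⟩ := List.mem_map.1 hx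
    exact hW t (hw t ht).2

/-- On an interval without break points, a function has the same punctured limit everywhere. -/
lemma eq_of_no_breaks {g : ℝ → α} {t₁ t₂ : ℝ} (h : ∀ t ∈ Set.Icc t₁ t₂, t ∉ breaks g)
    (h12 : t₁ ≤ t₂) {c₁ c₂ : α} (h₁ : ∀ᶠ t in 𝓝[≠] t₁, g t = c₁)
    (h₂ : ∀ᶠ t in 𝓝[≠] t₂, g t = c₂) : c₁ = c₂ := by
  have hstab : ∀ t ∈ Set.Icc t₁ t₂, ∃ c, ∀ᶠ t' in 𝓝[≠] t, g t' = c := fun t ht =>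
    not_not.1 (h t ht)
  have hpre : IsPreconnected (Set.Icc t₁ t₂) := isPreconnected_Icc
  have huniq : ∀ (t : ℝ) (c d : α), (∀ᶠ t' in 𝓝[≠] t, g t' = c) → (∀ᶠ t' in 𝓝[≠] t, g t' = d) →
      c = d := by
    intro t c d hc hd
    obtain ⟨t', h1, h2⟩ := (hc.and hd).exists
    rw [← h1, h2]
  -- The punctured limit is locally constant: the sets where it equals `c₁` and where it differs
  -- from `c₁` are both open, so connectedness of the interval decides.
  have hopen : ∀ p : α → Prop, IsOpen {t | ∃ c, p c ∧ ∀ᶠ t' in 𝓝[≠] t, g t' = c} := by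
    intro p
    rw [isOpen_iff_mem_nhds]
    rintro t ⟨c, hpc, hc⟩
    have h1 := eventually_eventually_nhdsWithin.2 hc
    rw [eventually_nhdsWithin_iff] at h1
    filter_upwards [h1] with t' ht'
    by_cases htt : t' = t
    · rw [htt]; exact ⟨c, hpc, hc⟩
    · refine ⟨c, hpc, ?_⟩
      have h2 := ht' htt
      rw [nhdsWithin_eq_nhds.2 (isOpen_compl_singleton.mem_nhds htt)] at h2
      exact h2.filter_mono nhdsWithin_le_nhds
  by_contra hne
  obtain ⟨t, ht, ⟨c, hc, hc'⟩, ⟨d, hd, hd'⟩⟩ := hpre _ _ (hopen (fun c => c = c₁))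
    (hopen (fun c => c ≠ c₁)) (fun t ht => by
      obtain ⟨c, hc⟩ := hstab t ht
      by_cases hcc : c = c₁
      · exact Or.inl ⟨c, hcc, hc⟩
      · exact Or.inr ⟨c, hcc, hc⟩)
    ⟨t₁, ⟨le_rfl, h12⟩, c₁, rfl, h₁⟩ ⟨t₂, ⟨h12, le_rfl⟩, c₂, Ne.symm hne, h₂⟩
  exact hd ((huniq t d c hd' hc').trans hc)

/-- If `φ` breaks at most `s` times while `g` has any given value, and `g` breaks at most `B`
times, then `φ` breaks at most `B + (B + 1) * s` times. -/
lemma encard_breaks_le_of_cells {B s : ℕ} (g : ℝ → α) (φ : ℝ → β) {J : Set ℝ}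
    (hJ : J.OrdConnected) (hB : (breaks g ∩ J).encard ≤ B)
    (hs : ∀ c, {t₀ | t₀ ∈ breaks φ ∩ J ∧ ∀ᶠ t in 𝓝[≠] t₀, g t = c}.encard ≤ s) :
    (breaks φ ∩ J).encard ≤ (B + (B + 1) * s : ℕ) := by
  classical
  have hfin : (breaks g ∩ J).Finite := Set.finite_of_encard_le_coe hB
  set A := hfin.toFinset with hA
  have hAB : A.card ≤ B := by
    rw [hfin.encard_eq_coe_toFinset_card] at hB
    exact_mod_cast hB
  have hcells : ((breaks φ ∩ J) \ breaks g).encard ≤ ((B + 1) * s : ℕ) := by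
    refine encard_le_of_forall_finset fun T hT => ?_
    -- The number of breaks of `g` before `t` identifies the cell of `t`; it ranges over `0, …, B`,
    -- hence `B + 1` cells with at most `s` breaks of `φ` in each, besides the breaks of `g`
    -- themselves.
    let κ : ℝ → ℕ := fun t => (A.filter (· < t)).card
    have himg : ∀ t ∈ T, κ t ∈ Finset.range (B + 1) := by
      intro t _
      have : κ t ≤ A.card := Finset.card_filter_le _ _
      simp only [Finset.mem_range]
      omega
    have hfib : ∀ c ∈ Finset.range (B + 1), (T.filter fun t => κ t = c).card ≤ s := by
      intro c _
      rcases (T.filter fun t => κ t = c).eq_empty_or_nonempty with he | ⟨t₁, ht₁⟩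
      · simp [he]
      · obtain ⟨hT₁, hκ₁⟩ := Finset.mem_filter.1 ht₁
        obtain ⟨c₁, hc₁⟩ := not_not.1 (hT hT₁).2
        have hkey : ∀ t t' : ℝ, t ∈ T → t' ∈ T → t ≤ t' → κ t = κ t' →
            ∀ r ∈ Set.Icc t t', r ∉ breaks g := by
          intro t t' ht ht' hle hκ r hr hrb
          have hrJ : r ∈ J := hJ.out (hT ht).1.2 (hT ht').1.2 hr
          have hrA : r ∈ A := hfin.mem_toFinset.2 ⟨hrb, hrJ⟩
          have hrt' : r < t' := lt_of_le_of_ne hr.2 fun h => (hT ht').2 (h ▸ hrb)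
          have hlt : κ t < κ t' := by
            refine Finset.card_lt_card ⟨fun x hx => ?_, fun hsub => ?_⟩
            · rw [Finset.mem_filter] at hx ⊢
              exact ⟨hx.1, hx.2.trans_le hle⟩
            · have := hsub (Finset.mem_filter.2 ⟨hrA, hrt'⟩)
              exact absurd (Finset.mem_filter.1 this).2 (not_lt.2 hr.1)
          omega
        have hsub : ((T.filter fun t => κ t = c : Finset ℝ) : Set ℝ) ⊆
            {t₀ | t₀ ∈ breaks φ ∩ J ∧ ∀ᶠ t in 𝓝[≠] t₀, g t = c₁} := by
          intro t ht
          obtain ⟨hTt, hκt⟩ := Finset.mem_filter.1 ht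
          refine ⟨(hT hTt).1, ?_⟩
          obtain ⟨c₂, hc₂⟩ := not_not.1 (hT hTt).2
          have : c₁ = c₂ := by
            rcases le_total t₁ t with h | h
            · exact eq_of_no_breaks (hkey t₁ t hT₁ hTt h (hκ₁.trans hκt.symm)) h hc₁ hc₂
            · exact (eq_of_no_breaks (hkey t t₁ hTt hT₁ h (hκt.trans hκ₁.symm)) h hc₂ hc₁).symm
          rwa [this]
        have := (Set.encard_le_encard hsub).trans (hs c₁)
        rw [Set.encard_coe_eq_coe_finsetCard] at this
        exact_mod_cast this
    have := Finset.card_le_mul_card_image_of_maps_to himg s hfib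
    simpa [Nat.mul_comm] using this
  have hsplit : breaks φ ∩ J ⊆ (breaks g ∩ J) ∪ ((breaks φ ∩ J) \ breaks g) := by
    intro t ht
    by_cases h : t ∈ breaks g
    · exact Or.inl ⟨h, ht.2⟩
    · exact Or.inr ⟨ht, h⟩
  calc (breaks φ ∩ J).encard ≤ _ := Set.encard_le_encard hsplit
    _ ≤ _ := Set.encard_union_le _ _
    _ ≤ (B : ℕ∞) + ((B + 1) * s : ℕ) := add_le_add hB hcells
    _ = _ := by push_cast; rfl

/-- A set of pairs whose second components lie in `T`, with at most `K` pairs over each of them. -/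
lemma encard_le_card_mul_of_fibers (S : Set (ℝ × α)) (T : Finset α) (K : ℕ)
    (hT : ∀ e ∈ S, e.2 ∈ T) (hK : ∀ a, {t | (t, a) ∈ S}.encard ≤ K) :
    S.encard ≤ (T.card * K : ℕ) := by
  classical
  refine encard_le_of_forall_finset fun E hE => ?_
  have := Finset.card_le_mul_card_image_of_maps_to (f := Prod.snd) (s := E) (t := T)
    (fun e he => hT e (hE he)) K fun a _ => ?_
  · simpa [Nat.mul_comm] using this
  · have h1 : Prod.fst '' ((E.filter fun e => e.2 = a : Finset (ℝ × α)) : Set (ℝ × α)) ⊆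
        {t | (t, a) ∈ S} := by
      rintro t ⟨⟨t', a'⟩, he, rfl⟩
      simp only [Finset.coe_filter, Set.mem_ofPred_eq] at he
      obtain ⟨h1, rfl⟩ := he
      exact hE h1
    have h2 := (Set.encard_le_encard h1).trans (hK a)
    rw [Set.InjOn.encard_image, Set.encard_coe_eq_coe_finsetCard] at h2
    · exact_mod_cast h2
    · rintro ⟨t, a₁⟩ h ⟨t', a₂⟩ h' (rfl : t = t')
      simp only [Finset.coe_filter, Set.mem_ofPred_eq] at h h'
      rw [h.2, h'.2]

end Breaks

/-! ### Configurations in general position -/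

section Generic

variable {n : ℕ} {z : Fin n → ℝ × ℝ} {a : WithBot (Fin n)} {b : Fin n} {c : WithTop (Fin n)}

/-- No two points have the same `x`-coordinate and no three points are collinear. -/
structure IsGeneric (z : Fin n → ℝ × ℝ) : Prop where
  fst_ne : ∀ i j, i ≠ j → (z i).1 ≠ (z j).1
  orient_ne : ∀ i j l, i ≠ j → j ≠ l → i ≠ l → orient z i j l ≠ 0

/-- The slope of the line through two points. -/
noncomputable def slopeOf (z : Fin n → ℝ × ℝ) (p q : Fin n) : ℝ :=
  ((z q).2 - (z p).2) / ((z q).1 - (z p).1)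

lemma orient_eq_slopeOf {p q r : Fin n} (hq : (z p).1 ≠ (z q).1) (hr : (z p).1 ≠ (z r).1) :
    orient z p q r =
      ((z q).1 - (z p).1) * ((z r).1 - (z p).1) * (slopeOf z p r - slopeOf z p q) := by
  have h1 : (z q).1 - (z p).1 ≠ 0 := sub_ne_zero.2 hq.symm
  have h2 : (z r).1 - (z p).1 ≠ 0 := sub_ne_zero.2 hr.symm
  unfold orient slopeOf
  field_simp

lemma orient_rotate (p q r : Fin n) : orient z p q r = orient z q r p := by
  unfold orient; ring

lemma orient_swap (p q r : Fin n) : orient z p q r = - orient z q p r := by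
  unfold orient; ring

@[simp] lemma orient_self_left (p q : Fin n) : orient z p q p = 0 := by
  unfold orient; ring

@[simp] lemma orient_self_right (p q : Fin n) : orient z p q q = 0 := by
  unfold orient; ring

/-- After division by the widths: the height of `w` over the line `u v` is the interpolated height
of the segment `l r` at the abscissa of `w`, plus the height of `w` over `l r`. The convexity
arguments below rest on this identity. -/
lemma orient_affine (u v l r w : Fin n) :
    ((z r).1 - (z l).1) * orient z u v w =
      ((z r).1 - (z w).1) * orient z u v l + ((z w).1 - (z l).1) * orient z u v r +
        ((z v).1 - (z u).1) * orient z l r w := by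
  unfold orient; ring

lemma ne_of_fst_lt {p q : Fin n} (h : (z p).1 < (z q).1) : p ≠ q := by
  rintro rfl
  exact h.false

namespace IsGeneric

variable (hz : IsGeneric z)
include hz

lemma precedes_iff {p q : Fin n} : Precedes z p q ↔ (z p).1 < (z q).1 := by
  constructor
  · rintro (h | ⟨h1, h2⟩)
    · exact h
    · have : p ≠ q := by rintro rfl; exact h2.false
      exact absurd h1 (hz.fst_ne p q this)
  · exact Or.inl

lemma fst_lt_of_le {p q : Fin n} (h : (z p).1 ≤ (z q).1) (hne : p ≠ q) : (z p).1 < (z q).1 :=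
  lt_of_le_of_ne h (hz.fst_ne p q hne)

lemma orient_ne_of_lt {p q r : Fin n} (h₁ : (z p).1 < (z q).1) (h₂ : (z q).1 < (z r).1) :
    orient z p r q ≠ 0 :=
  hz.orient_ne p r q (ne_of_fst_lt (h₁.trans h₂)) (ne_of_fst_lt h₂).symm (ne_of_fst_lt h₁)

/-- A point on or above a line lies above every segment that joins two points on or below the
line. -/
lemma orient_pos_of_line {u v l w r : Fin n} (huv : (z u).1 < (z v).1) (hlw : (z l).1 < (z w).1)
    (hwr : (z w).1 < (z r).1) (hl : orient z u v l ≤ 0) (hr : orient z u v r ≤ 0)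
    (hw : 0 ≤ orient z u v w) : 0 < orient z l r w := by
  refine lt_of_le_of_ne ?_ (hz.orient_ne_of_lt hlw hwr).symm
  by_contra hneg
  push Not at hneg
  have h := orient_affine (z := z) u v l r w
  have h1 : 0 ≤ ((z r).1 - (z l).1) * orient z u v w := mul_nonneg (by linarith) hw
  have h2 : ((z r).1 - (z w).1) * orient z u v l ≤ 0 :=
    mul_nonpos_of_nonneg_of_nonpos (by linarith) hl
  have h3 : ((z w).1 - (z l).1) * orient z u v r ≤ 0 :=
    mul_nonpos_of_nonneg_of_nonpos (by linarith) hr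
  have h4 : ((z v).1 - (z u).1) * orient z l r w < 0 :=
    mul_neg_of_pos_of_neg (by linarith) hneg
  linarith

omit hz in
-- Viewed from the middle point, convexity is a comparison of two slopes, so a hull test needs only
-- the extremal slope on each side.
lemma orient_pos_iff_slope {l w r : Fin n} (hlw : (z l).1 < (z w).1) (hwr : (z w).1 < (z r).1) :
    0 < orient z l r w ↔ slopeOf z w r < slopeOf z w l := by
  rw [orient_rotate, orient_rotate, orient_eq_slopeOf hlw.ne' hwr.ne]
  have h : ((z l).1 - (z w).1) * ((z r).1 - (z w).1) < 0 :=
    mul_neg_of_neg_of_pos (by linarith) (by linarith)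
  constructor
  · intro h1
    by_contra h2
    push Not at h2
    nlinarith [mul_nonneg (neg_pos.2 h).le (sub_nonneg.2 h2)]
  · intro h1
    exact mul_pos_of_neg_of_neg h (by linarith)

omit hz in
lemma orient_pos_iff_slope_of_lt {p q r : Fin n} (hq : (z p).1 < (z q).1)
    (hr : (z p).1 < (z r).1) : 0 < orient z p q r ↔ slopeOf z p q < slopeOf z p r := by
  rw [orient_eq_slopeOf hq.ne hr.ne]
  have h : 0 < ((z q).1 - (z p).1) * ((z r).1 - (z p).1) :=
    mul_pos (by linarith) (by linarith)
  rw [mul_pos_iff_of_pos_left h, sub_pos]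

/-! ### Hulls, the bridge and the chains in general position. -/

lemma mem_upperHull_iff {S : Set (Fin n)} {v : Fin n} :
    v ∈ upperHull z S ↔ v ∈ S ∧ ∀ p ∈ S, ∀ r ∈ S, (z p).1 < (z v).1 → (z v).1 < (z r).1 →
      0 < orient z p r v := by
  simp only [upperHull, Set.mem_ofPred_eq, hz.precedes_iff]

lemma le_of_mem_QL {p : Fin n} (hp : p ∈ QL z a b) : (z p).1 ≤ (z b).1 := by
  rcases hp.2 with rfl | h
  · exact le_rfl
  · exact (hz.precedes_iff.1 h).le

lemma le_of_mem_QR {p : Fin n} (hp : p ∈ QR z b c) : (z b).1 ≤ (z p).1 := by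
  rcases hp.1 with rfl | h
  · exact le_rfl
  · exact (hz.precedes_iff.1 h).le

omit hz in
lemma apex_mem_QL (h : Between z a c b) : b ∈ QL z a b := ⟨Or.inr h.1, Or.inl rfl⟩

omit hz in
lemma apex_mem_QR (h : Between z a c b) : b ∈ QR z b c := ⟨Or.inl rfl, Or.inr h.2⟩

lemma mem_QL_of_lt {p : Fin n} (hp : p ∈ QL z a b ∪ QR z b c) (h : (z p).1 < (z b).1) :
    p ∈ QL z a b :=
  hp.resolve_right fun h' => absurd (hz.le_of_mem_QR h') (not_le.2 h)

lemma mem_QR_of_lt {p : Fin n} (hp : p ∈ QL z a b ∪ QR z b c) (h : (z b).1 < (z p).1) :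
    p ∈ QR z b c :=
  hp.resolve_left fun h' => absurd (hz.le_of_mem_QL h') (not_le.2 h)

lemma lt_of_isBridge {u v : Fin n} (h : IsBridge z a b c u v) :
    (z u).1 < (z b).1 ∧ (z b).1 < (z v).1 := by
  obtain ⟨hu, hv, -, -, hb⟩ := h
  constructor
  · refine hz.fst_lt_of_le (hz.le_of_mem_QL hu.1) ?_
    rintro rfl
    simp at hb
  · refine hz.fst_lt_of_le (hz.le_of_mem_QR hv.1) ?_
    rintro rfl
    simp at hb

/-- The bridge is the segment from a point left of the apex to a point right of it that passes
highest above the apex. A point above its line could replace the endpoint on its own side and give a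
higher segment. -/
lemma exists_isBridge (hb : Between z a c b) (h : b ∉ upperHull z (QL z a b ∪ QR z b c)) :
    ∃ u v, IsBridge z a b c u v := by
  classical
  rw [hz.mem_upperHull_iff] at h
  push Not at h
  obtain ⟨l, hl, r, hr, hlb, hbr, hlr⟩ := h (Or.inl (apex_mem_QL hb))
  let T : Finset (Fin n × Fin n) := Finset.univ.filter fun p =>
    p.1 ∈ QL z a b ∧ (z p.1).1 < (z b).1 ∧ p.2 ∈ QR z b c ∧ (z b).1 < (z p.2).1
  have hlrT : (l, r) ∈ T := by
    simp only [T, Finset.mem_filter, Finset.mem_univ, true_and]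
    exact ⟨hz.mem_QL_of_lt hl hlb, hlb, hz.mem_QR_of_lt hr hbr, hbr⟩
  -- The quotient is the signed height of `b` over the line through the pair; it is nonpositive for
  -- `(l, r)`, so the minimizing segment passes above `b`.
  obtain ⟨⟨u, v⟩, huvT, hmin⟩ := T.exists_min_image
    (fun p => orient z p.1 p.2 b / ((z p.2).1 - (z p.1).1)) ⟨_, hlrT⟩
  have hmem : ∀ p q, (p, q) ∈ T ↔ (p ∈ QL z a b ∧ (z p).1 < (z b).1 ∧ q ∈ QR z b c ∧
      (z b).1 < (z q).1) := by
    intro p q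
    simp [T]
  obtain ⟨hu, hub, hv, hbv⟩ := (hmem u v).1 huvT
  have huv : (z u).1 < (z v).1 := hub.trans hbv
  have hbneg : orient z u v b < 0 := by
    refine lt_of_le_of_ne ?_ (hz.orient_ne_of_lt hub hbv)
    have h1 := hmin _ hlrT
    have h2 : orient z l r b / ((z r).1 - (z l).1) ≤ 0 :=
      div_nonpos_of_nonpos_of_nonneg hlr (by linarith)
    have h3 := h1.trans h2
    rwa [div_le_iff₀ (by linarith : (0 : ℝ) < (z v).1 - (z u).1), zero_mul] at h3
  have hall : ∀ w ∈ QL z a b ∪ QR z b c, orient z u v w ≤ 0 := by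
    intro w hw
    by_contra hpos
    push Not at hpos
    have hwb : w ≠ b := by rintro rfl; linarith
    rcases lt_or_gt_of_ne (hz.fst_ne w b hwb) with hlt | hgt
    · have h1 := hmin (w, v) ((hmem w v).2 ⟨hz.mem_QL_of_lt hw hlt, hlt, hv, hbv⟩)
      simp only at h1
      rw [div_le_div_iff₀ (by linarith) (by linarith)] at h1
      have h2 := orient_affine (z := z) u v w v b
      have h3 : 0 < ((z v).1 - (z b).1) * orient z u v w := mul_pos (by linarith) hpos
      rw [orient_self_right] at h2
      nlinarith
    · have h1 := hmin (u, w) ((hmem u w).2 ⟨hu, hub, hz.mem_QR_of_lt hw hgt, hgt⟩)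
      simp only at h1
      rw [div_le_div_iff₀ (by linarith) (by linarith)] at h1
      have h2 := orient_affine (z := z) u v u w b
      have h3 : 0 < ((z b).1 - (z u).1) * orient z u v w := mul_pos (by linarith) hpos
      rw [orient_self_left] at h2
      nlinarith
  refine ⟨u, v, ?_, ?_, hz.precedes_iff.2 huv, hall, hbneg⟩
  · exact hz.mem_upperHull_iff.2 ⟨hu, fun p hp r hr hpu hur =>
      hz.orient_pos_of_line huv hpu hur (hall p (Or.inl hp)) (hall r (Or.inl hr)) (by simp)⟩
  · exact hz.mem_upperHull_iff.2 ⟨hv, fun p hp r hr hpv hvr =>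
      hz.orient_pos_of_line huv hpv hvr (hall p (Or.inr hp)) (hall r (Or.inr hr)) (by simp)⟩

/-- Creations and destructions of the bridge thereby become changes of hull membership of the apex.
-/
lemma funnelEmpty_iff (hb : Between z a c b) :
    FunnelEmpty z a b c ↔ b ∈ upperHull z (QL z a b ∪ QR z b c) := by
  constructor
  · intro h
    by_contra h'
    exact h (hz.exists_isBridge hb h')
  · rintro h ⟨u, v, huv⟩
    have h1 := hz.lt_of_isBridge huv
    have h2 := (hz.mem_upperHull_iff.1 h).2 u (Or.inl huv.1.1) v (Or.inr huv.2.1.1) h1.1 h1.2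
    linarith [huv.2.2.2.2]

/-- The bridge spans such a vertex and is not below it. Together with the next lemma this replaces
the moving chain by two hulls, which can be followed separately. -/
lemma notMem_upperHull_of_mem_leftChain {p : Fin n} (hp : p ∈ leftChain z a b c) (hpb : p ≠ b)
    (hend : ¬ IsBridgeEndpoint z a b c p) :
    p ∉ upperHull z (QL z a b ∪ QR z b c) := by
  obtain ⟨hp1, hp2⟩ := hp
  obtain ⟨u, v, huv, hup⟩ := hp2.resolve_left hpb
  have hpu : p ≠ u := fun h => hend ⟨u, v, huv, Or.inl h⟩
  have hup' := hz.precedes_iff.1 (hup.resolve_left hpu)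
  have hpv : (z p).1 < (z v).1 :=
    (hz.le_of_mem_QL hp1.1).trans_lt (hz.lt_of_isBridge huv).2
  intro h
  have h2 := (hz.mem_upperHull_iff.1 h).2 u (Or.inl huv.1.1) v (Or.inr huv.2.1.1) hup' hpv
  linarith [huv.2.2.2.1 p (Or.inl hp1.1)]

lemma mem_leftChain_of_notMem_upperHull (hb : Between z a c b) {p : Fin n}
    (hp : p ∈ upperHull z (QL z a b)) (hpb : p ≠ b)
    (hpQ : p ∉ upperHull z (QL z a b ∪ QR z b c)) : p ∈ leftChain z a b c := by
  have hpb' : (z p).1 < (z b).1 := hz.fst_lt_of_le (hz.le_of_mem_QL hp.1) hpb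
  have hp' := (hz.mem_upperHull_iff.1 hp).2
  -- If the apex were on the hull of the union, every `r` to its right would be below the line `l
  -- b`, while `p` is above it; so `p` would be on that hull too.
  have hbQ : b ∉ upperHull z (QL z a b ∪ QR z b c) := by
    intro hbQ
    refine hpQ (hz.mem_upperHull_iff.2 ⟨Or.inl hp.1, fun l hl r hr hlp hpr => ?_⟩)
    have hlL := hz.mem_QL_of_lt hl (hlp.trans hpb')
    rcases hr with hr | hr
    · exact hp' l hlL r hr hlp hpr
    · rcases eq_or_ne r b with rfl | hrb
      · exact hp' l hlL r (apex_mem_QL hb) hlp hpr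
      · have hbr := hz.fst_lt_of_le (hz.le_of_mem_QR hr) hrb.symm
        have h1 := hp' l hlL b (apex_mem_QL hb) hlp hpb'
        have h2 := (hz.mem_upperHull_iff.1 hbQ).2 l hl r (Or.inr hr) (hlp.trans hpb') hbr
        have h3 : orient z l b r < 0 := by
          rw [orient_rotate, orient_rotate, orient_swap]; linarith
        exact hz.orient_pos_of_line (hlp.trans hpb') hlp hpr (by simp) h3.le h1.le
  obtain ⟨u, v, huv⟩ := hz.exists_isBridge hb hbQ
  refine ⟨hp, Or.inr ⟨u, v, huv, ?_⟩⟩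
  -- If `p` preceded the tangency point `u`, the same argument with `u` in place of the apex would
  -- put `p` on the hull of the union.
  by_contra hcon
  push Not at hcon
  rw [hz.precedes_iff, not_lt] at hcon
  have hpu := hz.fst_lt_of_le hcon.2 hcon.1
  obtain ⟨hub, hbv⟩ := hz.lt_of_isBridge huv
  refine hpQ (hz.mem_upperHull_iff.2 ⟨Or.inl hp.1, fun l hl r hr hlp hpr => ?_⟩)
  have hlL := hz.mem_QL_of_lt hl (hlp.trans hpb')
  rcases hr with hr' | hr'
  · exact hp' l hlL r hr' hlp hpr
  · have hur : (z u).1 < (z r).1 := hub.trans_le (hz.le_of_mem_QR hr')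
    have h1 := hp' l hlL u huv.1.1 hlp hpu
    have h2 := hz.orient_pos_of_line (hub.trans hbv) (hlp.trans hpu) hur
      (huv.2.2.2.1 l hl) (huv.2.2.2.1 r (Or.inr hr')) (by simp)
    have h3 : orient z l u r < 0 := by
      rw [orient_rotate, orient_rotate, orient_swap]; linarith
    exact hz.orient_pos_of_line (hlp.trans hpu) hlp hpr (by simp) h3.le h1.le

end IsGeneric

end Generic

/-! ### Visibility inside the funnel and tangents to the opposite hull. -/

section Visibility

variable {n : ℕ} {z : Fin n → ℝ × ℝ} {a : WithBot (Fin n)} {b : Fin n} {c : WithTop (Fin n)}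

lemma orient_swap_right (p q r : Fin n) : orient z p q r = - orient z p r q := by
  unfold orient; ring

/-- The affine function that vanishes on the line through `u` and `v`. -/
def lineForm (z : Fin n → ℝ × ℝ) (u v : Fin n) (w : ℝ × ℝ) : ℝ :=
  ((z v).1 - (z u).1) * (w.2 - (z u).2) - ((z v).2 - (z u).2) * (w.1 - (z u).1)

lemma lineForm_apply (u v w : Fin n) : lineForm z u v (z w) = orient z u v w := rfl

lemma lineForm_combination (u v : Fin n) (A B : ℝ × ℝ) {α β : ℝ} (h : α + β = 1) :
    lineForm z u v (α • A + β • B) = α * lineForm z u v A + β * lineForm z u v B := by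
  obtain rfl : β = 1 - α := by linarith
  simp only [lineForm, Prod.fst_add, Prod.snd_add, Prod.smul_fst, Prod.smul_snd, smul_eq_mul]
  ring

lemma mem_openSegment_of_lineForm_eq_zero {u v : Fin n} {w : ℝ × ℝ} (h : lineForm z u v w = 0)
    (hu : (z u).1 < w.1) (hv : w.1 < (z v).1) : w ∈ openSegment ℝ (z u) (z v) := by
  have hd : 0 < (z v).1 - (z u).1 := by linarith
  refine ⟨((z v).1 - w.1) / ((z v).1 - (z u).1), (w.1 - (z u).1) / ((z v).1 - (z u).1),
    div_pos (by linarith) hd, div_pos (by linarith) hd, ?_, ?_⟩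
  · field_simp
    ring
  · unfold lineForm at h
    ext
    · simp only [Prod.fst_add, Prod.smul_fst, smul_eq_mul]
      field_simp
      ring
    · simp only [Prod.snd_add, Prod.smul_snd, smul_eq_mul]
      field_simp
      linarith

namespace IsGeneric

lemma orient_neg_iff_slope_of_lt {p q r : Fin n} (hq : (z p).1 < (z q).1)
    (hr : (z p).1 < (z r).1) : orient z p q r < 0 ↔ slopeOf z p r < slopeOf z p q := by
  rw [← orient_pos_iff_slope_of_lt hr hq, orient_swap_right]
  constructor <;> intro h <;> linarith

lemma orient_nonpos_iff_slope_of_lt {p q r : Fin n} (hq : (z p).1 < (z q).1)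
    (hr : (z p).1 < (z r).1) : orient z p q r ≤ 0 ↔ slopeOf z p r ≤ slopeOf z p q := by
  rw [← not_lt, orient_pos_iff_slope_of_lt hq hr, not_lt]

lemma orient_pos_iff_slope_of_gt {p q r : Fin n} (hq : (z q).1 < (z p).1)
    (hr : (z r).1 < (z p).1) : 0 < orient z p q r ↔ slopeOf z p q < slopeOf z p r := by
  rw [orient_eq_slopeOf hq.ne' hr.ne']
  have h : 0 < ((z q).1 - (z p).1) * ((z r).1 - (z p).1) :=
    mul_pos_of_neg_of_neg (by linarith) (by linarith)
  rw [mul_pos_iff_of_pos_left h, sub_pos]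

variable (hz : IsGeneric z)
include hz

/-- Neither bridge can pass above the other at the apex. Adding the two affine identities gives four
nonpositive terms with sum zero; each vanishes, and general position makes the endpoints coincide.
-/
lemma isBridge_unique {u v u' v' : Fin n} (h : IsBridge z a b c u v)
    (h' : IsBridge z a b c u' v') : u' = u ∧ v' = v := by
  obtain ⟨hub, hbv⟩ := hz.lt_of_isBridge h
  obtain ⟨hub', hbv'⟩ := hz.lt_of_isBridge h'
  have e₁ := orient_affine (z := z) u v u' v' b
  have e₂ := orient_affine (z := z) u' v' u v b
  have n₁ : orient z u v u' ≤ 0 := h.2.2.2.1 u' (Or.inl h'.1.1)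
  have n₂ : orient z u v v' ≤ 0 := h.2.2.2.1 v' (Or.inr h'.2.1.1)
  have n₃ : orient z u' v' u ≤ 0 := h'.2.2.2.1 u (Or.inl h.1.1)
  have n₄ : orient z u' v' v ≤ 0 := h'.2.2.2.1 v (Or.inr h.2.1.1)
  have m₁ := mul_nonpos_of_nonneg_of_nonpos (sub_nonneg.2 hbv'.le) n₁
  have m₂ := mul_nonpos_of_nonneg_of_nonpos (sub_nonneg.2 hub'.le) n₂
  have m₃ := mul_nonpos_of_nonneg_of_nonpos (sub_nonneg.2 hbv.le) n₃
  have m₄ := mul_nonpos_of_nonneg_of_nonpos (sub_nonneg.2 hub.le) n₄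
  constructor
  · by_contra hne
    have h1 : orient z u v u' ≠ 0 := hz.orient_ne u v u' (ne_of_fst_lt (hub.trans hbv))
      (ne_of_fst_lt (hub'.trans hbv)).symm (Ne.symm hne)
    have h2 : ((z v').1 - (z b).1) * orient z u v u' = 0 := by linarith
    rcases mul_eq_zero.1 h2 with h3 | h3
    · linarith
    · exact h1 h3
  · by_contra hne
    have h1 : orient z u v v' ≠ 0 := hz.orient_ne u v v' (ne_of_fst_lt (hub.trans hbv))
      (Ne.symm hne) (ne_of_fst_lt (hub.trans hbv'))
    have h2 : ((z b).1 - (z u').1) * orient z u v v' = 0 := by linarith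
    rcases mul_eq_zero.1 h2 with h3 | h3
    · linarith
    · exact h1 h3

lemma exists_isBridge_of_mem_leftChain {q : Fin n} (hq : q ∈ leftChain z a b c) (hqb : q ≠ b) :
    ∃ u v, IsBridge z a b c u v ∧ (q = u ∨ (z u).1 < (z q).1) ∧ (z q).1 < (z b).1 := by
  obtain ⟨u, v, huv, h⟩ := hq.2.resolve_left hqb
  exact ⟨u, v, huv, h.imp_right hz.precedes_iff.1, hz.fst_lt_of_le (hz.le_of_mem_QL hq.1.1) hqb⟩

lemma le_of_mem_rightChain {u v p : Fin n} (huv : IsBridge z a b c u v)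
    (hp : p ∈ rightChain z a b c) : p = v ∨ (z p).1 < (z v).1 := by
  rcases hp.2 with rfl | ⟨u', v', h', h⟩
  · exact Or.inr (hz.lt_of_isBridge huv).2
  · obtain ⟨rfl, rfl⟩ := hz.isBridge_unique huv h'
    exact h.imp_right hz.precedes_iff.1

/-- The apex lies below every segment that joins the two chains. -/
lemma orient_apex_neg (hb : Between z a c b) {q p : Fin n} (hq : q ∈ leftChain z a b c)
    (hqb : q ≠ b) (hp : p ∈ rightChain z a b c) (hpb : p ≠ b) : orient z q p b < 0 := by
  obtain ⟨u, v, huv, huq, hqb'⟩ := hz.exists_isBridge_of_mem_leftChain hq hqb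
  obtain ⟨hub, hbv⟩ := hz.lt_of_isBridge huv
  have hbp : (z b).1 < (z p).1 := hz.fst_lt_of_le (hz.le_of_mem_QR hp.1.1) hpb.symm
  -- Seen from the apex, slopes do not decrease along `q`, `u`, `v`, `p`: by convexity of the left
  -- hull, by the bridge, and by convexity of the right hull.
  have h1 : slopeOf z b q ≤ slopeOf z b u := by
    rcases huq with rfl | huq
    · exact le_rfl
    · have := (hz.mem_upperHull_iff.1 hq.1).2 u huv.1.1 b (apex_mem_QL hb) huq hqb'
      rw [orient_rotate, orient_pos_iff_slope_of_gt hqb' hub] at this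
      exact this.le
  have h2 : slopeOf z b u ≤ slopeOf z b v := by
    have := huv.2.2.2.2.le
    rw [← not_lt, orient_pos_iff_slope hub hbv] at this
    exact not_lt.1 this
  have h3 : slopeOf z b v ≤ slopeOf z b p := by
    rcases hz.le_of_mem_rightChain huv hp with rfl | hpv
    · exact le_rfl
    · have := (hz.mem_upperHull_iff.1 hp.1).2 b (apex_mem_QR hb) v huv.2.1.1 hbp hpv
      rw [orient_pos_iff_slope_of_lt hbv hbp] at this
      exact this.le
  refine lt_of_le_of_ne ?_ (hz.orient_ne_of_lt hqb' hbp)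
  rw [← not_lt, orient_pos_iff_slope hqb' hbp]
  linarith

/-- A vertex of the left chain sees the point of tangency from it to the right hull. -/
lemma visible_of_tangent (hb : Between z a c b) {q r : Fin n} (hq : q ∈ leftChain z a b c)
    (hqb : q ≠ b) (hrR : r ∈ QR z b c) (hr : ∀ x ∈ QR z b c, orient z q r x ≤ 0) :
    Visible z a b c q r := by
  obtain ⟨u, v, huv, huq, hqb'⟩ := hz.exists_isBridge_of_mem_leftChain hq hqb
  obtain ⟨hub, hbv⟩ := hz.lt_of_isBridge huv
  have hvC : v ∈ rightChain z a b c := ⟨huv.2.1, Or.inr ⟨u, v, huv, Or.inl rfl⟩⟩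
  have hqR : ∀ x ∈ QR z b c, (z q).1 < (z x).1 := fun x hx => hqb'.trans_le (hz.le_of_mem_QR hx)
  have hqr := hqR r hrR
  have hrb : r ≠ b := by
    rintro rfl
    have h1 := hz.orient_apex_neg hb hq hqb hvC (ne_of_fst_lt hbv).symm
    have h2 := hr v huv.2.1.1
    rw [orient_swap_right] at h2
    linarith
  have hrv : r = v ∨ (z r).1 < (z v).1 := by
    by_contra hcon
    push Not at hcon
    have hvr := hz.fst_lt_of_le hcon.2 (Ne.symm hcon.1)
    have h1 := hz.orient_pos_of_line (hub.trans hbv) (hqb'.trans hbv) hvr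
      (huv.2.2.2.1 q (Or.inl hq.1.1)) (huv.2.2.2.1 r (Or.inr hrR)) (by simp)
    linarith [hr v huv.2.1.1]
  have hrC : r ∈ rightChain z a b c := by
    refine ⟨hz.mem_upperHull_iff.2 ⟨hrR, fun l hl s hs hlr hrs => ?_⟩,
      Or.inr ⟨u, v, huv, hrv.imp_right hz.precedes_iff.2⟩⟩
    exact hz.orient_pos_of_line hqr hlr hrs (hr l hl) (hr s hs) (by simp)
  refine ⟨hq, hqb, hrC, hrb, ?_⟩
  rcases huq with rfl | huq
  · left
    rcases hrv with rfl | hrv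
    · exact huv
    · have h1 := hr v huv.2.1.1
      have h2 := huv.2.2.2.1 r (Or.inr hrR)
      rw [orient_swap_right] at h2
      exact absurd (by linarith) (hz.orient_ne q r v (ne_of_fst_lt hqr) (ne_of_fst_lt hrv)
        (ne_of_fst_lt (hqr.trans hrv)))
  · right
    -- The open segment `q r` avoids the three boundary parts separately: beyond `q` the left chain
    -- is strictly below the line `q r`, the right chain touches that line only at `r`, and the
    -- segment stays strictly below the bridge.
    have hquv : orient z u v q < 0 := lt_of_le_of_ne (huv.2.2.2.1 q (Or.inl hq.1.1))
      (hz.orient_ne_of_lt huq (hqb'.trans hbv))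
    -- From `q` the slopes satisfy `j < u ≤ v ≤ r`, by the hull of `Q_L`, the bridge and the
    -- tangency at `r`.
    have hbelow : ∀ j ∈ QL z a b, (z q).1 < (z j).1 → orient z q r j < 0 := by
      intro j hj hqj
      have h1 := (hz.mem_upperHull_iff.1 hq.1).2 u huv.1.1 j hj huq hqj
      rw [orient_pos_iff_slope huq hqj] at h1
      have h2 : ¬ 0 < orient z u v q := by linarith
      rw [orient_pos_iff_slope huq (hqb'.trans hbv), not_lt] at h2
      have h3 := hr v huv.2.1.1
      rw [orient_nonpos_iff_slope_of_lt hqr (hqb'.trans hbv)] at h3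
      rw [orient_neg_iff_slope_of_lt hqr hqj]
      linarith
    rw [Set.disjoint_left]
    rintro w ⟨α, β, hα, hβ, hαβ, rfl⟩ hw
    have hH : lineForm z q r (α • z q + β • z r) = 0 := by
      rw [lineForm_combination _ _ _ _ hαβ, lineForm_apply, lineForm_apply]
      simp
    have hx : (α • z q + β • z r).1 = α * (z q).1 + β * (z r).1 := by simp
    have hx₁ : (z q).1 < (α • z q + β • z r).1 := by
      rw [hx]
      have : α * (z q).1 + β * (z r).1 = (z q).1 + β * ((z r).1 - (z q).1) := by
        rw [show α = 1 - β by linarith]; ring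
      rw [this]
      linarith [mul_pos hβ (sub_pos.2 hqr)]
    have hx₂ : (α • z q + β • z r).1 < (z r).1 := by
      rw [hx]
      have : α * (z q).1 + β * (z r).1 = (z r).1 - α * ((z r).1 - (z q).1) := by
        rw [show β = 1 - α by linarith]; ring
      rw [this]
      linarith [mul_pos hα (sub_pos.2 hqr)]
    rcases hw with (hw | hw) | hw
    · obtain ⟨i, hi, j, hj, hij, hcons, α', β', hα', hβ', hαβ', hw⟩ := hw
      rw [hz.precedes_iff] at hij
      have hxw : α' * (z i).1 + β' * (z j).1 = (α • z q + β • z r).1 := by rw [← hw]; simp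
      have hHw : α' * orient z q r i + β' * orient z q r j = 0 := by
        rw [← hH, ← hw, lineForm_combination _ _ _ _ hαβ']; rfl
      have hcase : (z q).1 ≤ (z i).1 ∨ (z j).1 ≤ (z q).1 := by
        have := hcons q hq
        rw [hz.precedes_iff, hz.precedes_iff] at this
        by_contra hn
        push Not at hn
        exact this hn
      obtain rfl : α' = 1 - β' := by linarith
      rcases hcase with hqi | hjq
      · have hHj := hbelow j hj.1.1 (hqi.trans_lt hij)
        rcases eq_or_ne i q with rfl | hiq
        · rw [orient_self_left] at hHw
          have : β' = 0 := by
            have : β' * orient z i r j = 0 := by linarith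
            exact (mul_eq_zero.1 this).resolve_right hHj.ne
          subst this
          linarith
        · have hHi := hbelow i hi.1.1 (hz.fst_lt_of_le hqi hiq.symm)
          rcases hβ'.eq_or_lt with h0 | h0
          · rw [← h0] at hHw; linarith
          · nlinarith [mul_nonneg hα' (neg_pos.2 hHi).le, mul_pos h0 (neg_pos.2 hHj)]
      · nlinarith [mul_nonneg hα' (sub_pos.2 hij).le]
    · obtain ⟨i, hi, j, hj, hij, -, α', β', hα', hβ', hαβ', hw⟩ := hw
      rw [hz.precedes_iff] at hij
      have hxw : α' * (z i).1 + β' * (z j).1 = (α • z q + β • z r).1 := by rw [← hw]; simp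
      have hHw : α' * orient z q r i + β' * orient z q r j = 0 := by
        rw [← hH, ← hw, lineForm_combination _ _ _ _ hαβ']; rfl
      obtain rfl : α' = 1 - β' := by linarith
      rcases eq_or_ne i r with rfl | hir
      · nlinarith [mul_nonneg hβ' (sub_pos.2 hij).le]
      · have hHi : orient z q r i < 0 := lt_of_le_of_ne (hr i hi.1.1)
          (hz.orient_ne q r i (ne_of_fst_lt hqr) hir.symm (ne_of_fst_lt (hqR i hi.1.1)))
        have hHj := hr j hj.1.1
        rcases hα'.eq_or_lt with h0 | h0
        · have hβ1 : β' = 1 := by linarith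
          subst hβ1
          have hHj0 : orient z q r j = 0 := by linarith
          have hjr : j = r := by
            by_contra hjr
            exact hz.orient_ne q r j (ne_of_fst_lt hqr) (Ne.symm hjr)
              (ne_of_fst_lt (hqR j hj.1.1)) hHj0
          subst hjr
          linarith
        · nlinarith [mul_pos h0 (neg_pos.2 hHi), mul_nonneg hβ' (neg_nonneg.2 hHj)]
    · obtain ⟨u', v', huv', α', β', hα', hβ', hαβ', hw⟩ := hw
      obtain ⟨rfl, rfl⟩ := hz.isBridge_unique huv huv'
      have h1 : lineForm z u' v' (α • z q + β • z r) = 0 := by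
        rw [← hw, lineForm_combination _ _ _ _ hαβ', lineForm_apply, lineForm_apply]
        simp
      rw [lineForm_combination _ _ _ _ hαβ, lineForm_apply, lineForm_apply] at h1
      have h2 := huv.2.2.2.1 r (Or.inr hrR)
      nlinarith [mul_pos hα (neg_pos.2 hquv), mul_nonneg hβ.le (neg_nonneg.2 h2)]

/-- A vertex of the left chain sees nothing to the right of the point of tangency from it to the
right hull. -/
lemma not_visible_of_lt_tangent (hb : Between z a c b) {q r p : Fin n}
    (hrC : r ∈ rightChain z a b c) (hr : ∀ x ∈ QR z b c, orient z q r x ≤ 0)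
    (hrp : (z r).1 < (z p).1) : ¬ Visible z a b c q p := by
  classical
  rintro ⟨hq, hqb, hp, hpb, hvis⟩
  have hqb' : (z q).1 < (z b).1 := hz.fst_lt_of_le (hz.le_of_mem_QL hq.1.1) hqb
  have hqr : (z q).1 < (z r).1 := hqb'.trans_le (hz.le_of_mem_QR hrC.1.1)
  have hpos : 0 < orient z q p r := by
    have h1 := hr p hp.1.1
    rw [orient_swap_right] at h1
    exact lt_of_le_of_ne (by linarith) (hz.orient_ne_of_lt hqr hrp).symm
  rcases hvis with hbr | hdis
  · linarith [hbr.2.2.2.1 r (Or.inr hrC.1.1)]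
  · have hbneg := hz.orient_apex_neg hb hq hqb hp hpb
    have hbC : b ∈ rightChain z a b c := by
      refine ⟨hz.mem_upperHull_iff.2 ⟨apex_mem_QR hb, fun l hl s _ hlb _ => ?_⟩, Or.inl rfl⟩
      exact absurd (hz.le_of_mem_QR hl) (not_le.2 hlb)
    -- The tangency point `r` is above the segment `q p` and the apex is below it, so some edge of
    -- the right chain crosses it: `j` is the first chain vertex above the line and `i` its
    -- predecessor.
    obtain ⟨j, hjT, hjmin⟩ := (Finset.univ.filter fun j => j ∈ rightChain z a b c ∧
      0 < orient z q p j).exists_min_image (fun j => (z j).1) ⟨r, by simp [hrC, hpos]⟩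
    simp only [Finset.mem_filter, Finset.mem_univ, true_and] at hjT hjmin
    have hjr := hjmin r ⟨hrC, hpos⟩
    have hbj : (z b).1 < (z j).1 := by
      refine hz.fst_lt_of_le (hz.le_of_mem_QR hjT.1.1.1) ?_
      rintro rfl
      linarith [hjT.2]
    obtain ⟨i, hiT, himax⟩ := (Finset.univ.filter fun i => i ∈ rightChain z a b c ∧
      (z i).1 < (z j).1).exists_max_image (fun j => (z j).1) ⟨b, by simp [hbC, hbj]⟩
    simp only [Finset.mem_filter, Finset.mem_univ, true_and] at hiT himax
    have hi0 : orient z q p i ≤ 0 := by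
      by_contra hcon
      push Not at hcon
      exact absurd (hjmin i ⟨hiT.1, hcon⟩) (not_le.2 hiT.2)
    have hd : 0 < orient z q p j - orient z q p i := by linarith [hjT.2]
    -- The weights of the crossing point of the edge `i j` with the line `q p`.
    set α := orient z q p j / (orient z q p j - orient z q p i) with hα
    set β := -orient z q p i / (orient z q p j - orient z q p i) with hβ
    have hα0 : 0 ≤ α := div_nonneg hjT.2.le hd.le
    have hβ0 : 0 ≤ β := div_nonneg (by linarith) hd.le
    have hαβ : α + β = 1 := by
      rw [hα, hβ]; field_simp; ring
    have hzero : lineForm z q p (α • z i + β • z j) = 0 := by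
      rw [lineForm_combination _ _ _ _ hαβ, lineForm_apply, lineForm_apply, hα, hβ]
      field_simp
      ring
    have hbi := hz.le_of_mem_QR hiT.1.1.1
    have hx : (α • z i + β • z j).1 = (z i).1 + β * ((z j).1 - (z i).1) := by
      simp only [Prod.fst_add, Prod.smul_fst, smul_eq_mul]
      rw [show α = 1 - β by linarith]
      ring
    have hx' : (α • z i + β • z j).1 = (z j).1 - α * ((z j).1 - (z i).1) := by
      simp only [Prod.fst_add, Prod.smul_fst, smul_eq_mul]
      rw [show β = 1 - α by linarith]
      ring
    have h1 := mul_nonneg hβ0 (sub_pos.2 hiT.2).le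
    have h2 := mul_nonneg hα0 (sub_pos.2 hiT.2).le
    refine Set.disjoint_left.1 hdis
      (mem_openSegment_of_lineForm_eq_zero hzero (by linarith) (by linarith)) ?_
    refine Or.inl (Or.inr ⟨i, hiT.1, j, hjT.1, hz.precedes_iff.2 hiT.2, fun k hk hk' => ?_,
      α, β, hα0, hβ0, hαβ, rfl⟩)
    rw [hz.precedes_iff, hz.precedes_iff] at hk'
    exact absurd (himax k ⟨hk, hk'.2⟩) (not_le.2 hk'.1)

/-- The rightmost vertex seen from a vertex `q` of the left chain maximizes the slope of its
connection to `q` among all points of `Q_R`. -/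
lemma slopeOf_le_of_rightmost_visible (hb : Between z a c b) {q p : Fin n}
    (hqp : Visible z a b c q p) (hmax : ∀ q', Visible z a b c q q' → q' = p ∨ Precedes z q' p) :
    ∀ x ∈ QR z b c, slopeOf z q x ≤ slopeOf z q p := by
  classical
  obtain ⟨r, hrT, hrmax⟩ := (Finset.univ.filter fun x => x ∈ QR z b c).exists_max_image
    (fun x => slopeOf z q x) ⟨b, by simp [apex_mem_QR hb]⟩
  simp only [Finset.mem_filter, Finset.mem_univ, true_and] at hrT hrmax
  have hqR : ∀ x ∈ QR z b c, (z q).1 < (z x).1 := fun x hx =>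
    (hz.fst_lt_of_le (hz.le_of_mem_QL hqp.1.1.1) hqp.2.1).trans_le (hz.le_of_mem_QR hx)
  have hr : ∀ x ∈ QR z b c, orient z q r x ≤ 0 := fun x hx =>
    (orient_nonpos_iff_slope_of_lt (hqR r hrT) (hqR x hx)).2 (hrmax x hx)
  have hvis := hz.visible_of_tangent hb hqp.1 hqp.2.1 hrT hr
  rcases hmax r hvis with rfl | hlt
  · exact hrmax
  · exact absurd hqp (hz.not_visible_of_lt_tangent hb hvis.2.2.1 hr (hz.precedes_iff.1 hlt))

end IsGeneric

end Visibility

/-! ### Reflection in a vertical line -/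

section Mirror

variable {n : ℕ} {z : Fin n → ℝ × ℝ} {a : WithBot (Fin n)} {b : Fin n} {c : WithTop (Fin n)}

/-- The reflection in the `y`-axis. -/
def reflect (w : ℝ × ℝ) : ℝ × ℝ := (-w.1, w.2)

/-- The reflected configuration. -/
def mirror (z : Fin n → ℝ × ℝ) : Fin n → ℝ × ℝ := fun i => reflect (z i)

/-- The right endpoint of a configuration as left endpoint of the reflected one. -/
def flipTop : WithTop (Fin n) → WithBot (Fin n)
  | none => ⊥
  | some i => (i : WithBot (Fin n))

/-- The left endpoint of a configuration as right endpoint of the reflected one. -/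
def flipBot : WithBot (Fin n) → WithTop (Fin n)
  | none => ⊤
  | some i => (i : WithTop (Fin n))

lemma flipTop_eq_coe_iff {i : Fin n} :
    flipTop c = (i : WithBot (Fin n)) ↔ c = (i : WithTop (Fin n)) := by
  induction c using WithTop.recTopCoe with
  | top => exact ⟨fun h => absurd h WithBot.bot_ne_coe, fun h => absurd h WithTop.top_ne_coe⟩
  | coe j => exact WithBot.coe_inj.trans WithTop.coe_inj.symm

lemma flipBot_eq_coe_iff {i : Fin n} :
    flipBot a = (i : WithTop (Fin n)) ↔ a = (i : WithBot (Fin n)) := by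
  induction a using WithBot.recBotCoe with
  | bot => exact ⟨fun h => absurd h WithTop.top_ne_coe, fun h => absurd h WithBot.bot_ne_coe⟩
  | coe j => exact WithTop.coe_inj.trans WithBot.coe_inj.symm

lemma reflect_reflect (w : ℝ × ℝ) : reflect (reflect w) = w := by simp [reflect]

lemma reflect_combination (α β : ℝ) (A B : ℝ × ℝ) :
    reflect (α • A + β • B) = α • reflect A + β • reflect B := by
  ext
  · simp [reflect]; ring
  · simp [reflect]

lemma reflect_mem_segment {A B w : ℝ × ℝ} :
    reflect w ∈ segment ℝ (reflect A) (reflect B) ↔ w ∈ segment ℝ A B := by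
  constructor
  · rintro ⟨α, β, h1, h2, h3, h⟩
    exact ⟨α, β, h1, h2, h3, by
      rw [← reflect_combination] at h
      rw [← reflect_reflect w, ← h, reflect_reflect]⟩
  · rintro ⟨α, β, h1, h2, h3, rfl⟩
    exact ⟨α, β, h1, h2, h3, (reflect_combination _ _ _ _).symm⟩

lemma reflect_mem_openSegment {A B w : ℝ × ℝ} :
    reflect w ∈ openSegment ℝ (reflect A) (reflect B) ↔ w ∈ openSegment ℝ A B := by
  constructor
  · rintro ⟨α, β, h1, h2, h3, h⟩
    exact ⟨α, β, h1, h2, h3, by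
      rw [← reflect_combination] at h
      rw [← reflect_reflect w, ← h, reflect_reflect]⟩
  · rintro ⟨α, β, h1, h2, h3, rfl⟩
    exact ⟨α, β, h1, h2, h3, (reflect_combination _ _ _ _).symm⟩

lemma orient_mirror (p q r : Fin n) : orient (mirror z) p q r = - orient z p q r := by
  simp only [orient, mirror, reflect]; ring

lemma slopeOf_mirror (p q : Fin n) : slopeOf (mirror z) p q = - slopeOf z p q := by
  simp only [slopeOf, mirror, reflect]
  rw [← div_neg]
  congr 1
  ring

namespace IsGeneric

variable (hz : IsGeneric z)
include hz

lemma mirror : IsGeneric (mirror z) where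
  fst_ne i j hij h := hz.fst_ne i j hij (neg_injective h)
  orient_ne i j l h1 h2 h3 := by
    rw [orient_mirror, neg_ne_zero]
    exact hz.orient_ne i j l h1 h2 h3

lemma precedes_mirror {p q : Fin n} :
    Precedes (KineticTriangulation.mirror z) p q ↔ Precedes z q p := by
  rw [hz.mirror.precedes_iff, hz.precedes_iff]
  exact neg_lt_neg_iff

lemma after_flipTop {p : Fin n} :
    After (KineticTriangulation.mirror z) (flipTop c) p ↔ Before z p c := by
  simp only [After, Before, flipTop_eq_coe_iff, hz.precedes_mirror]

lemma before_flipBot {p : Fin n} :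
    Before (KineticTriangulation.mirror z) p (flipBot a) ↔ After z a p := by
  simp only [After, Before, flipBot_eq_coe_iff, hz.precedes_mirror]

lemma between_mirror {p : Fin n} :
    Between (KineticTriangulation.mirror z) (flipTop c) (flipBot a) p ↔ Between z a c p := by
  rw [Between, Between, hz.after_flipTop, hz.before_flipBot, and_comm]

lemma QL_mirror : QL (KineticTriangulation.mirror z) (flipTop c) b = QR z b c := by
  ext p
  simp only [QL, QR, Set.mem_ofPred_eq, hz.after_flipTop, hz.precedes_mirror, flipTop_eq_coe_iff]
  exact and_comm

lemma QR_mirror : QR (KineticTriangulation.mirror z) b (flipBot a) = QL z a b := by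
  ext p
  simp only [QL, QR, Set.mem_ofPred_eq, hz.before_flipBot, hz.precedes_mirror, flipBot_eq_coe_iff]
  exact and_comm

/-- Reflection reverses the `x`-order and negates orientations; exchanging the two outer points of a
triple undoes the sign. -/
lemma upperHull_mirror (S : Set (Fin n)) :
    upperHull (KineticTriangulation.mirror z) S = upperHull z S := by
  ext v
  simp only [upperHull, Set.mem_ofPred_eq, hz.precedes_mirror, orient_mirror]
  refine and_congr_right fun _ => ⟨fun h p hp r hr h1 h2 => ?_, fun h p hp r hr h1 h2 => ?_⟩
  · rw [orient_swap]; exact h r hr p hp h2 h1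
  · rw [← orient_swap]; exact h r hr p hp h2 h1

lemma isBridge_mirror {u v : Fin n} :
    IsBridge (KineticTriangulation.mirror z) (flipTop c) b (flipBot a) v u ↔
      IsBridge z a b c u v := by
  simp only [IsBridge, hz.QL_mirror, hz.QR_mirror, hz.upperHull_mirror, hz.precedes_mirror,
    orient_mirror, ← orient_swap, Set.union_comm (QR z b c)]
  tauto

lemma leftChain_mirror :
    leftChain (KineticTriangulation.mirror z) (flipTop c) b (flipBot a) = rightChain z a b c := by
  ext p
  simp only [leftChain, rightChain, Set.mem_ofPred_eq, hz.QL_mirror, hz.upperHull_mirror,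
    hz.isBridge_mirror, hz.precedes_mirror]
  rw [exists_comm]

lemma rightChain_mirror :
    rightChain (KineticTriangulation.mirror z) (flipTop c) b (flipBot a) = leftChain z a b c := by
  ext p
  simp only [leftChain, rightChain, Set.mem_ofPred_eq, hz.QR_mirror, hz.upperHull_mirror,
    hz.isBridge_mirror, hz.precedes_mirror]
  rw [exists_comm]

lemma isBridgeEndpoint_mirror {p : Fin n} :
    IsBridgeEndpoint (KineticTriangulation.mirror z) (flipTop c) b (flipBot a) p ↔
      IsBridgeEndpoint z a b c p := by
  simp only [IsBridgeEndpoint, hz.isBridge_mirror]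
  rw [exists_comm]
  simp only [or_comm]

lemma reflect_mem_polyline_mirror {S : Set (Fin n)} {w : ℝ × ℝ} :
    reflect w ∈ polyline (KineticTriangulation.mirror z) S ↔ w ∈ polyline z S := by
  simp only [polyline, Set.mem_ofPred_eq, hz.precedes_mirror, KineticTriangulation.mirror,
    reflect_mem_segment]
  constructor
  · rintro ⟨i, hi, j, hj, h1, h2, h3⟩
    exact ⟨j, hj, i, hi, h1, fun k hk h => h2 k hk h.symm, segment_symm ℝ (z i) (z j) ▸ h3⟩
  · rintro ⟨i, hi, j, hj, h1, h2, h3⟩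
    exact ⟨j, hj, i, hi, h1, fun k hk h => h2 k hk h.symm, segment_symm ℝ (z i) (z j) ▸ h3⟩

lemma reflect_mem_funnelBoundary_mirror {w : ℝ × ℝ} :
    reflect w ∈ funnelBoundary (KineticTriangulation.mirror z) (flipTop c) b (flipBot a) ↔
      w ∈ funnelBoundary z a b c := by
  have h : (∃ u v, IsBridge z a b c v u ∧ w ∈ segment ℝ (z u) (z v)) ↔
      ∃ u v, IsBridge z a b c u v ∧ w ∈ segment ℝ (z u) (z v) := by
    rw [exists_comm]
    constructor
    · rintro ⟨u, v, h1, h2⟩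
      exact ⟨u, v, h1, segment_symm ℝ (z v) (z u) ▸ h2⟩
    · rintro ⟨u, v, h1, h2⟩
      exact ⟨u, v, h1, segment_symm ℝ (z v) (z u) ▸ h2⟩
  simp only [funnelBoundary, Set.mem_union, hz.leftChain_mirror, hz.rightChain_mirror,
    hz.reflect_mem_polyline_mirror, Set.mem_ofPred_eq, hz.isBridge_mirror]
  simp only [KineticTriangulation.mirror, reflect_mem_segment, h]
  tauto

lemma visible_mirror {p q : Fin n} :
    Visible (KineticTriangulation.mirror z) (flipTop c) b (flipBot a) q p ↔
      Visible z a b c p q := by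
  have h : Disjoint (openSegment ℝ (KineticTriangulation.mirror z q)
      (KineticTriangulation.mirror z p))
      (funnelBoundary (KineticTriangulation.mirror z) (flipTop c) b (flipBot a)) ↔
      Disjoint (openSegment ℝ (z p) (z q)) (funnelBoundary z a b c) := by
    rw [openSegment_symm, Set.disjoint_left, Set.disjoint_left]
    constructor
    · intro h w hw hw'
      exact h (reflect_mem_openSegment.2 hw) (hz.reflect_mem_funnelBoundary_mirror.2 hw')
    · intro h w hw hw'
      rw [← reflect_reflect w] at hw hw'
      exact h (reflect_mem_openSegment.1 hw) (hz.reflect_mem_funnelBoundary_mirror.1 hw')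
  simp only [Visible, h, hz.leftChain_mirror, hz.rightChain_mirror, hz.isBridge_mirror]
  tauto

lemma notMem_upperHull_of_mem_rightChain {p : Fin n} (hp : p ∈ rightChain z a b c) (hpb : p ≠ b)
    (hend : ¬ IsBridgeEndpoint z a b c p) :
    p ∉ upperHull z (QL z a b ∪ QR z b c) := by
  rw [← hz.leftChain_mirror] at hp
  rw [← hz.isBridgeEndpoint_mirror] at hend
  have := hz.mirror.notMem_upperHull_of_mem_leftChain hp hpb hend
  rwa [hz.QL_mirror, hz.QR_mirror, hz.upperHull_mirror, Set.union_comm] at this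

lemma mem_rightChain_of_notMem_upperHull (hb : Between z a c b) {p : Fin n}
    (hp : p ∈ upperHull z (QR z b c)) (hpb : p ≠ b)
    (hpQ : p ∉ upperHull z (QL z a b ∪ QR z b c)) : p ∈ rightChain z a b c := by
  rw [← hz.leftChain_mirror]
  refine hz.mirror.mem_leftChain_of_notMem_upperHull (hz.between_mirror.2 hb) ?_ hpb ?_
  · rwa [hz.QL_mirror, hz.upperHull_mirror]
  · rwa [hz.QL_mirror, hz.QR_mirror, hz.upperHull_mirror, Set.union_comm]

/-- The leftmost vertex seen from a vertex `q` of the right chain minimizes the slope of its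
connection to `q` among all points of `Q_L`. -/
lemma le_slopeOf_of_leftmost_visible (hb : Between z a c b) {q p : Fin n}
    (hqp : Visible z a b c p q) (hmin : ∀ q', Visible z a b c q' q → q' = p ∨ Precedes z p q') :
    ∀ x ∈ QL z a b, slopeOf z q p ≤ slopeOf z q x := by
  intro x hx
  have h := hz.mirror.slopeOf_le_of_rightmost_visible (hz.between_mirror.2 hb)
    (hz.visible_mirror.2 hqp) (fun q' hq' => by
      rw [hz.precedes_mirror]
      exact hmin q' (hz.visible_mirror.1 hq')) x (by rwa [hz.QR_mirror])
  rw [slopeOf_mirror, slopeOf_mirror] at h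
  linarith

end IsGeneric

end Mirror

/-! ### Slope envelopes of moving points -/

section Envelope

variable {n k s : ℕ} {P : Fin n → ℝ → ℝ × ℝ}

/-- No general position is assumed: the zeros of `orient` to be counted occur at degenerate times,
where points may coincide or be aligned vertically. -/
lemma collinear_of_orient_eq_zero {z : Fin n → ℝ × ℝ} {i j l : Fin n} (h : orient z i j l = 0) :
    Collinear ℝ ({z i, z j, z l} : Set (ℝ × ℝ)) := by
  rw [collinear_iff_of_mem (p₀ := z i) (by simp)]
  unfold orient at h
  by_cases hx : (z j).1 - (z i).1 = 0
  · by_cases hy : (z j).2 - (z i).2 = 0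
    · refine ⟨z l - z i, ?_⟩
      have hj : z j = z i := Prod.ext (by linarith) (by linarith)
      simp only [Set.mem_insert_iff, Set.mem_singleton_iff, vadd_eq_add]
      rintro p (rfl | rfl | rfl)
      · exact ⟨0, by simp⟩
      · exact ⟨0, by simp [hj]⟩
      · exact ⟨1, by simp⟩
    · refine ⟨z j - z i, ?_⟩
      simp only [Set.mem_insert_iff, Set.mem_singleton_iff, vadd_eq_add]
      rintro p (rfl | rfl | rfl)
      · exact ⟨0, by simp⟩
      · exact ⟨1, by simp⟩
      · refine ⟨((z l).2 - (z i).2) / ((z j).2 - (z i).2), ?_⟩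
        ext
        · simp only [Prod.fst_add, Prod.smul_fst, Prod.fst_sub, smul_eq_mul]
          rw [hx] at h ⊢
          have : (z l).1 - (z i).1 = 0 := by
            rw [zero_mul, zero_sub, neg_eq_zero] at h
            exact (mul_eq_zero.1 h).resolve_left hy
          linarith
        · simp only [Prod.snd_add, Prod.smul_snd, Prod.snd_sub, smul_eq_mul]
          field_simp
          ring
  · refine ⟨z j - z i, ?_⟩
    simp only [Set.mem_insert_iff, Set.mem_singleton_iff, vadd_eq_add]
    rintro p (rfl | rfl | rfl)
    · exact ⟨0, by simp⟩
    · exact ⟨1, by simp⟩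
    · refine ⟨((z l).1 - (z i).1) / ((z j).1 - (z i).1), ?_⟩
      ext
      · simp only [Prod.fst_add, Prod.smul_fst, Prod.fst_sub, smul_eq_mul]
        field_simp
        ring
      · simp only [Prod.snd_add, Prod.smul_snd, Prod.snd_sub, smul_eq_mul]
        field_simp
        linarith

lemma pos_iff_of_ne_zero_on_Icc {f : ℝ → ℝ} (hf : Continuous f) {t t' : ℝ} (h : t ≤ t')
    (h0 : ∀ r ∈ Set.Icc t t', f r ≠ 0) : 0 < f t ↔ 0 < f t' := by
  constructor
  · intro h1
    by_contra h2
    obtain ⟨r, hr, hr0⟩ := intermediate_value_Icc' h hf.continuousOn ⟨not_lt.1 h2, h1.le⟩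
    exact h0 r hr hr0
  · intro h1
    by_contra h2
    obtain ⟨r, hr, hr0⟩ := intermediate_value_Icc h hf.continuousOn ⟨not_lt.1 h2, h1.le⟩
    exact h0 r hr hr0

/-- The break points of the sign of a continuous function are zeros of the function. -/
lemma breaks_pos_subset {f : ℝ → ℝ} (hf : Continuous f) :
    breaks (fun t => 0 < f t) ⊆ {t | f t = 0} := by
  intro t ht
  by_contra h0
  refine ht ⟨0 < f t, ?_⟩
  refine Filter.Eventually.filter_mono nhdsWithin_le_nhds ?_
  rcases lt_or_gt_of_ne (show f t ≠ 0 from h0) with h | h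
  · filter_upwards [hf.continuousAt.eventually_lt continuousAt_const h] with r hr
    simp [hr.not_gt, h.not_gt]
  · filter_upwards [continuousAt_const.eventually_lt hf.continuousAt h] with r hr
    simp [hr, h]

open Classical in
/-- The point of `D t` that maximizes `ε` times the slope of its connection to `p`. -/
noncomputable def slopeEnvelope (P : Fin n → ℝ → ℝ × ℝ) (ε : ℝ) (p : Fin n)
    (D : ℝ → Set (Fin n)) (t : ℝ) : Option (Fin n) :=
  if h : ∃ x ∈ D t, ∀ y ∈ D t, ε * slopeOf (conf P t) p y ≤ ε * slopeOf (conf P t) p x then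
    some h.choose else none

lemma slopeEnvelope_spec {ε : ℝ} {p x : Fin n} {D : ℝ → Set (Fin n)} {t : ℝ}
    (h : slopeEnvelope P ε p D t = some x) :
    x ∈ D t ∧ ∀ y ∈ D t, ε * slopeOf (conf P t) p y ≤ ε * slopeOf (conf P t) p x := by
  unfold slopeEnvelope at h
  split_ifs at h with h1
  obtain rfl := Option.some.inj h
  exact h1.choose_spec

/-- A finite nonempty set has a maximizer, so the value `none` occurs only over an empty domain. -/
lemma eq_empty_of_slopeEnvelope_eq_none {ε : ℝ} {p : Fin n} {D : ℝ → Set (Fin n)} {t : ℝ}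
    (h : slopeEnvelope P ε p D t = none) : D t = ∅ := by
  classical
  unfold slopeEnvelope at h
  split_ifs at h with h1
  by_contra hne
  obtain ⟨y, hy⟩ := Set.nonempty_iff_ne_empty.2 hne
  obtain ⟨x, hx, hmax⟩ := (Finset.univ.filter (· ∈ D t)).exists_max_image
    (fun x => ε * slopeOf (conf P t) p x) ⟨y, by simpa using hy⟩
  exact h1 ⟨x, by simpa using hx, fun y hy => hmax y (by simpa using hy)⟩

/-- Near which times the point `x` may enter or leave the set `D t`, and on which side of `p` the
sets lie. -/
structure IsEnvelopeDomain (P : Fin n → ℝ → ℝ × ℝ) (J : Set ℝ) (ε : ℝ) (p : Fin n)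
    (A : Fin n → Set ℝ) (D : ℝ → Set (Fin n)) : Prop where
  side : ∀ t x, x ∈ D t → 0 < ε * ((P x t).1 - (P p t).1)
  mem_iff : ∀ x, ∀ t ∈ J, ∀ t' ∈ J, t ≤ t' → (∀ r ∈ Set.Icc t t', r ∉ A x) →
    (x ∈ D t ↔ x ∈ D t')

lemma IsEnvelopeDomain.ne {J : Set ℝ} {ε : ℝ} {p : Fin n} {A : Fin n → Set ℝ}
    {D : ℝ → Set (Fin n)} (hD : IsEnvelopeDomain P J ε p A D) {t : ℝ} {x : Fin n} (hx : x ∈ D t) :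
    p ≠ x := by
  rintro rfl
  have := hD.side t p hx
  simp at this

lemma IsEnvelopeDomain.fst_mul_pos {J : Set ℝ} {ε : ℝ} {p : Fin n} {A : Fin n → Set ℝ}
    {D : ℝ → Set (Fin n)} (hD : IsEnvelopeDomain P J ε p A D) {t : ℝ} {x y : Fin n}
    (hx : x ∈ D t) (hy : y ∈ D t) : 0 < ((P x t).1 - (P p t).1) * ((P y t).1 - (P p t).1) := by
  have h := mul_pos (hD.side t x hx) (hD.side t y hy)
  have h2 : ε * ((P x t).1 - (P p t).1) * (ε * ((P y t).1 - (P p t).1)) =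
    ε ^ 2 * (((P x t).1 - (P p t).1) * ((P y t).1 - (P p t).1)) := by ring
  rw [h2] at h
  exact pos_of_mul_pos_right h (sq_nonneg ε)

/-- In general position, the maximizing point is strictly better than any other one. -/
lemma IsEnvelopeDomain.mul_orient_neg {J : Set ℝ} {ε : ℝ} {p : Fin n} {A : Fin n → Set ℝ}
    {D : ℝ → Set (Fin n)} (hD : IsEnvelopeDomain P J ε p A D) (hε : ε ≠ 0) {t : ℝ}
    (ht : IsGeneric (conf P t)) {x y : Fin n} (hx : x ∈ D t) (hy : y ∈ D t) (hxy : x ≠ y)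
    (h : ε * slopeOf (conf P t) p y ≤ ε * slopeOf (conf P t) p x) :
    ε * orient (conf P t) p x y < 0 := by
  have h1 := hD.fst_mul_pos hx hy
  refine lt_of_le_of_ne ?_ (mul_ne_zero hε (ht.orient_ne p x y (hD.ne hx) hxy (hD.ne hy)))
  rw [orient_eq_slopeOf (ht.fst_ne _ _ (hD.ne hx)) (ht.fst_ne _ _ (hD.ne hy))]
  have h3 := mul_nonpos_of_nonneg_of_nonpos h1.le (sub_nonpos.2 h)
  calc _ = _ := by rw [mul_left_comm, mul_sub ε]; rfl
    _ ≤ 0 := h3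

/-- In general position the maximizer is unique, so the arbitrary choice in `slopeEnvelope` matters
only at degenerate times, which `breaks` can ignore. -/
lemma slopeEnvelope_eq_some {J : Set ℝ} {ε : ℝ} {p : Fin n} {A : Fin n → Set ℝ}
    {D : ℝ → Set (Fin n)} (hD : IsEnvelopeDomain P J ε p A D) (hε : ε ≠ 0) {t : ℝ}
    (ht : IsGeneric (conf P t)) {x : Fin n} (hx : x ∈ D t)
    (hmax : ∀ y ∈ D t, ε * slopeOf (conf P t) p y ≤ ε * slopeOf (conf P t) p x) :
    slopeEnvelope P ε p D t = some x := by
  cases h : slopeEnvelope P ε p D t with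
  | none => exact absurd hx (by simp [eq_empty_of_slopeEnvelope_eq_none h])
  | some y =>
    obtain ⟨hy, hymax⟩ := slopeEnvelope_spec h
    by_contra hne
    have hxy : x ≠ y := fun h => hne (by rw [h])
    have h1 := hD.mul_orient_neg hε ht hx hy hxy (hmax y hy)
    have h2 := hD.mul_orient_neg hε ht hy hx hxy.symm (hymax x hx)
    rw [orient_swap_right] at h2
    linarith

lemma continuous_orient (hP : ∀ i, Continuous (P i)) (i j l : Fin n) :
    Continuous fun t => orient (conf P t) i j l := by
  unfold orient conf
  have := hP i
  have := hP j
  have := hP l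
  fun_prop

lemma IsPseudoAlgebraic.finite_compl_isGeneric (hP : IsPseudoAlgebraic k s P) :
    {t | IsGeneric (conf P t)}ᶜ.Finite := by
  have h1 : (⋃ i, ⋃ j, ⋃ (_ : i ≠ j), {t | (P i t).1 = (P j t).1}).Finite :=
    Set.finite_iUnion fun i => Set.finite_iUnion fun j => Set.finite_iUnion fun h =>
      Set.finite_of_encard_le_coe (hP.swaps i j h)
  have h2 : (⋃ i, ⋃ j, ⋃ l, ⋃ (_ : i ≠ j), ⋃ (_ : j ≠ l), ⋃ (_ : i ≠ l),
      {t | Collinear ℝ ({P i t, P j t, P l t} : Set (ℝ × ℝ))}).Finite :=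
    Set.finite_iUnion fun i => Set.finite_iUnion fun j => Set.finite_iUnion fun l =>
      Set.finite_iUnion fun h => Set.finite_iUnion fun h' => Set.finite_iUnion fun h'' =>
        Set.finite_of_encard_le_coe (hP.collinear i j l h h' h'')
  refine (h1.union h2).subset fun t ht => ?_
  by_contra hn
  simp only [Set.mem_union, Set.mem_iUnion, Set.mem_ofPred_eq, not_or, not_exists] at hn
  exact ht ⟨fun i j hij h => hn.1 i j hij h, fun i j l h h' h'' h0 =>
    hn.2 i j l h h' h'' (collinear_of_orient_eq_zero (z := conf P t) h0)⟩

/-- The number of times of `A` before `t`. -/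
noncomputable def countBefore (A : Set ℝ) (t : ℝ) : ℕ := {r | r ∈ A ∧ r < t}.ncard

lemma countBefore_mono {A : Set ℝ} (hA : A.Finite) {t t' : ℝ} (h : t ≤ t') :
    countBefore A t ≤ countBefore A t' :=
  Set.ncard_le_ncard (fun _ hr => ⟨hr.1, hr.2.trans_le h⟩) (hA.subset fun _ hr => hr.1)

/-- The count is over times strictly before, so a time of `A` equal to `t` already raises the count
at a later `t'`; only `t'` has to be excluded separately. -/
lemma notMem_of_countBefore_eq {A : Set ℝ} (hA : A.Finite) {t t' : ℝ}
    (h : countBefore A t = countBefore A t') (ht' : t' ∉ A) : ∀ r ∈ Set.Icc t t', r ∉ A := by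
  intro r hr hrA
  have hrt' : r < t' := lt_of_le_of_ne hr.2 fun h => ht' (h ▸ hrA)
  have : countBefore A t < countBefore A t' := by
    refine Set.ncard_lt_ncard ⟨fun x hx => ⟨hx.1, hx.2.trans_le (hr.1.trans hr.2)⟩, fun hsub => ?_⟩
      (hA.subset fun _ hr => hr.1)
    exact absurd (hsub ⟨hrA, hrt'⟩).2 (not_lt.2 hr.1)
  omega

/-- The complexity of a slope envelope. -/
lemma encard_breaks_slopeEnvelope_le (hP : IsPseudoAlgebraic k s P) {J : Set ℝ}
    (hJ : J.OrdConnected) {ε : ℝ} (hε : ε ≠ 0) {p : Fin n} {A : Fin n → Set ℝ}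
    {D : ℝ → Set (Fin n)} (hD : IsEnvelopeDomain P J ε p A D) {κ : ℕ}
    (hA : ∀ x, (A x).encard ≤ κ) (hAG : ∀ t, IsGeneric (conf P t) → ∀ x, t ∉ A x)
    (Q : Finset (Fin n)) (hQ : ∀ t ∈ J, D t ⊆ Q) :
    (breaks (slopeEnvelope P ε p D) ∩ interior J).encard ≤
      lam (s + 2) (Q.card * (κ + 1) + 1) := by
  classical
  have hAfin : ∀ x, (A x).Finite := fun x => Set.finite_of_encard_le_coe (hA x)
  -- Each point is split into symbols labelled by the number of its crossings so far. During one
  -- label its domain membership cannot change, so a symbol seen at two generic times stays in the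
  -- domain in between.
  let g : ℝ → Option (Fin n × ℕ) := fun t =>
    (slopeEnvelope P ε p D t).map fun x => (x, countBefore (A x) t)
  have hg : breaks (slopeEnvelope P ε p D) ⊆ breaks g := by
    have h := breaks_comp_subset (fun o : Option (Fin n × ℕ) => o.map Prod.fst) g
    have h2 : (fun t => (g t).map Prod.fst) = slopeEnvelope P ε p D := by
      funext t
      simp [g, Option.map_map, Function.comp_def]
    rwa [h2] at h
  have hgsome : ∀ t x d, g t = some (x, d) →
      slopeEnvelope P ε p D t = some x ∧ countBefore (A x) t = d := by
    intro t x d h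
    obtain ⟨y, hy, hyd⟩ := Option.map_eq_some_iff.1 h
    obtain ⟨rfl, rfl⟩ := Prod.mk.inj hyd
    exact ⟨hy, rfl⟩
  have hgnone : ∀ t, g t = none → D t = ∅ := fun t h =>
    eq_empty_of_slopeEnvelope_eq_none (Option.map_eq_none_iff.1 h)
  -- The value `none` counts as one more symbol, for times with empty domain.
  let W : Finset (Option (Fin n × ℕ)) := insert none ((Q ×ˢ Finset.range (κ + 1)).image some)
  have hWcard : W.card ≤ Q.card * (κ + 1) + 1 := by
    refine (Finset.card_insert_le _ _).trans (Nat.add_le_add_right ?_ _)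
    exact Finset.card_image_le.trans (by simp)
  refine (Set.encard_le_encard (Set.inter_subset_inter_left _ hg)).trans
    (encard_breaks_le_lam g hP.finite_compl_isGeneric W hWcard ?_ ?_)
  · rintro t ⟨htJ, -⟩
    cases h : g t with
    | none => simp [W]
    | some e =>
      obtain ⟨x, d⟩ := e
      obtain ⟨h1, rfl⟩ := hgsome t x d h
      have hx : x ∈ Q := hQ t htJ (slopeEnvelope_spec h1).1
      have hd : countBefore (A x) t ≤ κ := by
        have h2 : countBefore (A x) t ≤ (A x).ncard :=
          Set.ncard_le_ncard (fun _ hr => hr.1) (hAfin x)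
        have h3 := hA x
        rw [← (hAfin x).cast_ncard_eq] at h3
        exact h2.trans (by exact_mod_cast h3)
      simp [W, hx, hd]
  · intro X Y hXY σ hσ hσJ hσg
    have hbetween : ∀ t₁ t₂ t₃, t₁ ∈ J → t₃ ∈ J → IsGeneric (conf P t₃) → t₁ ≤ t₂ →
        t₂ ≤ t₃ → ∀ x d, g t₁ = some (x, d) → g t₃ = some (x, d) →
        x ∈ D t₂ ∧ countBefore (A x) t₂ = d := by
      intro t₁ t₂ t₃ h₁ h₃ hgen h12 h23 x d hx₁ hx₃
      obtain ⟨e₁, rfl⟩ := hgsome _ _ _ hx₁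
      obtain ⟨e₃, hd⟩ := hgsome _ _ _ hx₃
      have hfree := notMem_of_countBefore_eq (hAfin x) hd.symm (hAG t₃ hgen x)
      refine ⟨(hD.mem_iff x t₁ h₁ t₂ (hJ.out h₁ h₃ ⟨h12, h23⟩) h12
        fun r hr => hfree r ⟨hr.1, hr.2.trans h23⟩).1 (slopeEnvelope_spec e₁).1, ?_⟩
      have m1 := countBefore_mono (hAfin x) h12
      have m2 := countBefore_mono (hAfin x) h23
      omega
    have hbet : ∀ i j l : Fin (s + 2 + 2), i ≤ j → j ≤ l → ∀ x d, g (σ i) = some (x, d) →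
        g (σ l) = some (x, d) → x ∈ D (σ j) ∧ countBefore (A x) (σ j) = d :=
      fun i j l hij hjl x d h1 h2 => hbetween _ _ _ (hσJ i).1 (hσJ l).1 (hσJ l).2
        (hσ.monotone hij) (hσ.monotone hjl) x d h1 h2
    have g0 : g (σ ⟨0, by omega⟩) = X := by simpa using hσg ⟨0, by omega⟩
    have g1 : g (σ ⟨1, by omega⟩) = Y := by simpa using hσg ⟨1, by omega⟩
    have g2 : g (σ ⟨2, by omega⟩) = X := by simpa using hσg ⟨2, by omega⟩
    have g3 : g (σ ⟨3, by omega⟩) = Y := by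
      have := hσg ⟨3, by omega⟩
      rwa [if_neg (show ¬ Even 3 by decide)] at this
    -- The symbol `none` cannot alternate with a point, whose domain would be empty between two of
    -- its occurrences; four terms suffice to see this, and the order is at least two.
    cases X with
    | none =>
      cases Y with
      | none => exact hXY rfl
      | some e =>
        have := (hbet ⟨1, by omega⟩ ⟨2, by omega⟩ ⟨3, by omega⟩ (Fin.mk_le_mk.2 (by omega))
          (Fin.mk_le_mk.2 (by omega)) e.1 e.2 g1 g3).1
        rw [hgnone _ g2] at this
        exact this
    | some e =>
      obtain ⟨x, d⟩ := e
      have hmid := hbet ⟨0, by omega⟩ ⟨1, by omega⟩ ⟨2, by omega⟩ (Fin.mk_le_mk.2 (by omega))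
        (Fin.mk_le_mk.2 (by omega)) x d g0 g2
      cases Y with
      | none =>
        have := hmid.1
        rw [hgnone _ g1] at this
        exact this
      | some e' =>
        obtain ⟨y, d'⟩ := e'
        by_cases hxy : x = y
        -- Two symbols of the same point cannot alternate, because the crossing count is monotone.
        · subst hxy
          have := (hgsome _ _ _ g1).2
          rw [hmid.2] at this
          exact hXY (by rw [this])
        -- At each of the `s + 2` inner terms one of the points is on the envelope and the other,
        -- occurring just before and just after, is in the domain. So the two slopes are compared
        -- there with alternating outcome, which forces `s + 1` collinearities.
        · have hmem : ∀ i : Fin (s + 2 + 2), 1 ≤ i.1 → i.1 ≤ s + 2 →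
              x ∈ D (σ i) ∧ y ∈ D (σ i) := by
            intro i hi1 hi2
            have hprev := hσg ⟨i.1 - 1, by omega⟩
            have hcur := hσg i
            have hnext := hσg ⟨i.1 + 1, by omega⟩
            have hle1 : (⟨i.1 - 1, by omega⟩ : Fin (s + 2 + 2)) ≤ i := by
              rw [Fin.le_def]; simp
            have hle2 : i ≤ (⟨i.1 + 1, by omega⟩ : Fin (s + 2 + 2)) := by
              rw [Fin.le_def]; simp
            by_cases hev : Even i.1
            · have ho1 : ¬ Even (i.1 - 1) := by
                rw [Nat.not_even_iff_odd]; exact Nat.Even.sub_odd hi1 hev odd_one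
              have ho2 : ¬ Even (i.1 + 1) := by rw [Nat.even_add_one]; simpa using hev
              rw [if_neg ho1] at hprev
              rw [if_neg ho2] at hnext
              rw [if_pos hev] at hcur
              exact ⟨(slopeEnvelope_spec (hgsome _ _ _ hcur).1).1,
                (hbet _ i _ hle1 hle2 y d' hprev hnext).1⟩
            · have ho1 : Even (i.1 - 1) :=
                Nat.Odd.sub_odd (Nat.not_even_iff_odd.1 hev) odd_one
              have ho2 : Even (i.1 + 1) := Nat.even_add_one.2 hev
              rw [if_pos ho1] at hprev
              rw [if_pos ho2] at hnext
              rw [if_neg hev] at hcur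
              exact ⟨(hbet _ i _ hle1 hle2 x d hprev hnext).1,
                (slopeEnvelope_spec (hgsome _ _ _ hcur).1).1⟩
          have hpx : p ≠ x := hD.ne hmid.1
          have hpy : p ≠ y := hD.ne (slopeEnvelope_spec (hgsome _ _ _ g1).1).1
          have hsign : ∀ i : Fin (s + 2 + 2), 1 ≤ i.1 → i.1 ≤ s + 2 →
              (0 < ε * orient (conf P (σ i)) p x y ↔ ¬ Even i.1) := by
            intro i hi1 hi2
            obtain ⟨hx, hy⟩ := hmem i hi1 hi2
            have hcur := hσg i
            by_cases hev : Even i.1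
            · rw [if_pos hev] at hcur
              have := hD.mul_orient_neg hε (hσJ i).2 hx hy hxy
                ((slopeEnvelope_spec (hgsome _ _ _ hcur).1).2 y hy)
              simp [hev, this.not_gt]
            · rw [if_neg hev] at hcur
              have := hD.mul_orient_neg hε (hσJ i).2 hy hx (Ne.symm hxy)
                ((slopeEnvelope_spec (hgsome _ _ _ hcur).1).2 x hx)
              rw [orient_swap_right] at this
              simp only [hev, not_false_eq_true, iff_true]
              linarith
          have hzero : ∀ i : Fin (s + 1), ∃ r, σ ⟨i.1 + 1, by omega⟩ ≤ r ∧
              r ≤ σ ⟨i.1 + 2, by omega⟩ ∧ orient (conf P r) p x y = 0 := by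
            intro i
            by_contra hn
            push Not at hn
            have hcont : Continuous fun t => ε * orient (conf P t) p x y :=
              continuous_const.mul (continuous_orient hP.continuous p x y)
            have h := pos_iff_of_ne_zero_on_Icc hcont
              (hσ.monotone (show (⟨i.1 + 1, by omega⟩ : Fin (s + 2 + 2)) ≤ ⟨i.1 + 2, by omega⟩ by
                rw [Fin.le_def]; simp))
              (fun r hr => mul_ne_zero hε (hn r hr.1 hr.2))
            rw [hsign _ (by simp) (show i.1 + 1 ≤ s + 2 by omega),
              hsign _ (by simp) (show i.1 + 2 ≤ s + 2 by omega)] at h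
            simp only [Nat.even_add_one] at h
            tauto
          choose ζ hζ1 hζ2 hζ0 using hzero
          -- The inner sample times are in general position, hence are not zeros; this keeps
          -- consecutive zeros distinct.
          have hgen0 : ∀ i j, ζ i ≠ σ j ∨ ¬ (1 ≤ j.1 ∧ j.1 ≤ s + 2) := by
            intro i j
            by_contra hn
            push Not at hn
            exact (hσJ j).2.orient_ne p x y hpx hxy hpy (hn.1 ▸ hζ0 i)
          have hζmono : StrictMono ζ := by
            intro i j hij
            have h1 : ζ i < σ ⟨i.1 + 2, by omega⟩ := by
              refine lt_of_le_of_ne (hζ2 i) ((hgen0 i _).resolve_right ?_)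
              simp only [not_not]
              omega
            have h2 : σ ⟨i.1 + 2, by omega⟩ ≤ σ ⟨j.1 + 1, by omega⟩ :=
              hσ.monotone (by rw [Fin.le_def]; simp; omega)
            exact (h1.trans_le h2).trans_le (hζ1 j)
          have hcard := hP.collinear p x y hpx hxy hpy
          have hrange : Set.range ζ ⊆
              {t | Collinear ℝ ({P p t, P x t, P y t} : Set (ℝ × ℝ))} := by
            rintro _ ⟨i, rfl⟩
            exact collinear_of_orient_eq_zero (z := conf P (ζ i)) (hζ0 i)
          have h1 := (Set.encard_le_encard hrange).trans hcard
          rw [← Set.image_univ, hζmono.injective.encard_image, Set.encard_univ,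
            ENat.card_eq_coe_fintype_card, Fintype.card_fin] at h1
          have h2 : s + 1 ≤ s := by exact_mod_cast h1
          omega

end Envelope

/-! ### The events of a kinetic pseudo-triangle -/

lemma Precedes.trans {n : ℕ} {z : Fin n → ℝ × ℝ} {p q r : Fin n} (h₁ : Precedes z p q)
    (h₂ : Precedes z q r) : Precedes z p r := by
  rcases h₁ with h₁ | ⟨h₁, h₁'⟩ <;> rcases h₂ with h₂ | ⟨h₂, h₂'⟩
  · exact Or.inl (h₁.trans h₂)
  · exact Or.inl (h₂ ▸ h₁)
  · exact Or.inl (h₁ ▸ h₂)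
  · exact Or.inr ⟨h₁.trans h₂, h₁'.trans h₂'⟩

lemma precedes_iff_of_fst_ne {n : ℕ} {P : Fin n → ℝ → ℝ × ℝ} (hP : ∀ i, Continuous (P i))
    {x e : Fin n} {t t' : ℝ} (h : t ≤ t') (hne : ∀ r ∈ Set.Icc t t', (P x r).1 ≠ (P e r).1) :
    ((P x t).1 < (P e t).1 ↔ (P x t').1 < (P e t').1) ∧
    (Precedes (conf P t) x e ↔ Precedes (conf P t') x e) ∧
    (Precedes (conf P t) e x ↔ Precedes (conf P t') e x) := by
  have hx := hP x
  have he := hP e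
  have h1 := pos_iff_of_ne_zero_on_Icc (f := fun r => (P e r).1 - (P x r).1) (by fun_prop) h
    (fun r hr => sub_ne_zero.2 (hne r hr).symm)
  have h2 := pos_iff_of_ne_zero_on_Icc (f := fun r => (P x r).1 - (P e r).1) (by fun_prop) h
    (fun r hr => sub_ne_zero.2 (hne r hr))
  simp only [sub_pos] at h1 h2
  have ht := hne t ⟨le_rfl, h⟩
  have ht' := hne t' ⟨h, le_rfl⟩
  simp only [Precedes, conf, ht, ht.symm, ht', ht'.symm, false_and, or_false]
  exact ⟨h1, h1, h2⟩

namespace PseudoTriangle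

variable {n k s : ℕ} {P : Fin n → ℝ → ℝ × ℝ} {π : Equiv.Perm (Fin n)} (τ : PseudoTriangle P π)

lemma ordConnected_lifespan : τ.lifespan.OrdConnected := by
  obtain ⟨t, -, h⟩ := τ.isLifespan
  rw [h]
  exact isPreconnected_connectedComponentIn.ordConnected

lemma between_apex {t : ℝ} (ht : t ∈ τ.lifespan) :
    Between (conf P t) τ.left τ.right τ.apex := by
  obtain ⟨t', -, h⟩ := τ.isLifespan
  rw [h] at ht
  exact (connectedComponentIn_subset _ _ ht).2.1

/-- The points that take part in the pseudo-triangle: `P_τ` and the corners. -/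
noncomputable def vertices : Finset (Fin n) :=
  (Set.toFinite (τ.points ∪ {e | τ.IsCorner e})).toFinset

lemma mem_vertices {p : Fin n} : p ∈ τ.vertices ↔ p ∈ τ.points ∨ τ.IsCorner p := by
  simp [vertices]

lemma card_vertices_le : τ.vertices.card ≤ τ.N + 3 := by
  have hsub : τ.points ∪ {e | τ.IsCorner e} ⊆ τ.points ∪ ({e | τ.left = (e : WithBot (Fin n))} ∪
      ({τ.apex} ∪ {e | τ.right = (e : WithTop (Fin n))})) := by
    rintro e (h | h)
    · exact Or.inl h
    · exact Or.inr h
  have h1 : {e : Fin n | τ.left = (e : WithBot (Fin n))}.ncard ≤ 1 :=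
    (Set.ncard_le_one_iff (Set.toFinite _)).2 fun {a b} ha hb =>
      WithBot.coe_inj.1 (ha.symm.trans hb)
  have h2 : {e : Fin n | τ.right = (e : WithTop (Fin n))}.ncard ≤ 1 :=
    (Set.ncard_le_one_iff (Set.toFinite _)).2 fun {a b} ha hb =>
      WithTop.coe_inj.1 (ha.symm.trans hb)
  rw [vertices, ← Set.ncard_eq_toFinset_card]
  refine (Set.ncard_le_ncard hsub (Set.toFinite _)).trans ?_
  refine (Set.ncard_union_le _ _).trans (Nat.add_le_add_left ?_ _)
  refine (Set.ncard_union_le _ _).trans ?_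
  have h3 := Set.ncard_union_le {τ.apex} {e : Fin n | τ.right = (e : WithTop (Fin n))}
  rw [Set.ncard_singleton] at h3
  omega

/-- The times at which `x` has the same `x`-coordinate as `p` or a corner. -/
def crossings (p x : Fin n) : Set ℝ :=
  {t | ∃ e, (e = p ∨ τ.IsCorner e) ∧ x ≠ e ∧ (P x t).1 = (P e t).1}

/-- At most four points can be met: `p`, the apex and the two endpoints, an infinite endpoint
contributing nothing. -/
lemma encard_crossings_le (hP : IsPseudoAlgebraic k s P) (p x : Fin n) :
    (τ.crossings p x).encard ≤ (4 * k : ℕ) := by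
  have key : ∀ φ : Fin n → Prop, (∀ e e', φ e → φ e' → e = e') →
      {t | ∃ e, φ e ∧ x ≠ e ∧ (P x t).1 = (P e t).1}.encard ≤ k := by
    intro φ hφ
    by_cases h : ∃ e, φ e ∧ x ≠ e
    · obtain ⟨e, he, hxe⟩ := h
      refine le_trans (Set.encard_le_encard ?_) (hP.swaps x e hxe)
      rintro t ⟨e', he', -, ht⟩
      rwa [hφ e' e he' he] at ht
    · refine le_trans (Set.encard_le_encard (t := ∅) ?_) (by simp)
      rintro t ⟨e, he, hxe, -⟩
      exact h ⟨e, he, hxe⟩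
  have hsub : τ.crossings p x ⊆
      ({t | ∃ e, e = p ∧ x ≠ e ∧ (P x t).1 = (P e t).1} ∪
        {t | ∃ e : Fin n, τ.left = (e : WithBot (Fin n)) ∧ x ≠ e ∧ (P x t).1 = (P e t).1}) ∪
      ({t | ∃ e, e = τ.apex ∧ x ≠ e ∧ (P x t).1 = (P e t).1} ∪
        {t | ∃ e : Fin n, τ.right = (e : WithTop (Fin n)) ∧ x ≠ e ∧ (P x t).1 = (P e t).1}) := by
    rintro t ⟨e, (h | h | h | h), hx⟩
    · exact Or.inl (Or.inl ⟨e, h, hx⟩)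
    · exact Or.inl (Or.inr ⟨e, h, hx⟩)
    · exact Or.inr (Or.inl ⟨e, h, hx⟩)
    · exact Or.inr (Or.inr ⟨e, h, hx⟩)
  calc (τ.crossings p x).encard ≤ _ := Set.encard_le_encard hsub
    _ ≤ _ := Set.encard_union_le _ _
    _ ≤ ((k : ℕ∞) + k) + (k + k) := by
        refine add_le_add ((Set.encard_union_le _ _).trans (add_le_add ?_ ?_))
          ((Set.encard_union_le _ _).trans (add_le_add ?_ ?_))
        · exact key _ fun e e' h h' => h.trans h'.symm
        · exact key _ fun e e' h h' => WithBot.coe_inj.1 (h.symm.trans h')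
        · exact key _ fun e e' h h' => h.trans h'.symm
        · exact key _ fun e e' h h' => WithTop.coe_inj.1 (h.symm.trans h')
    _ = (4 * k : ℕ) := by push_cast; ring

lemma notMem_crossings {t : ℝ} (ht : IsGeneric (conf P t)) (p x : Fin n) :
    t ∉ τ.crossings p x := by
  rintro ⟨e, -, hxe, h⟩
  exact ht.fst_ne x e hxe h

lemma crossings_apex_subset (p x : Fin n) : τ.crossings τ.apex x ⊆ τ.crossings p x := by
  rintro t ⟨e, he, h⟩
  refine ⟨e, Or.inr ?_, h⟩
  rcases he with rfl | he
  · exact Or.inr (Or.inl rfl)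
  · exact he

/-- The set `S t` consists of vertices of `τ`, and a point enters or leaves it only when it crosses
a corner of `τ`. -/
structure IsCornerDetermined (S : ℝ → Set (Fin n)) : Prop where
  subset : ∀ t ∈ τ.lifespan, S t ⊆ τ.vertices
  mem_iff : ∀ x, ∀ t ∈ τ.lifespan, ∀ t' ∈ τ.lifespan, t ≤ t' →
    (∀ r ∈ Set.Icc t t', r ∉ τ.crossings τ.apex x) → (x ∈ S t ↔ x ∈ S t')

lemma IsCornerDetermined.union {S S' : ℝ → Set (Fin n)} (h : τ.IsCornerDetermined S)
    (h' : τ.IsCornerDetermined S') : τ.IsCornerDetermined fun t => S t ∪ S' t where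
  subset t ht := Set.union_subset (h.subset t ht) (h'.subset t ht)
  mem_iff x t ht t' ht' hle hr :=
    or_congr (h.mem_iff x t ht t' ht' hle hr) (h'.mem_iff x t ht t' ht' hle hr)

variable {τ}

lemma precedes_corner_iff (hP : IsPseudoAlgebraic k s P) {x e : Fin n} {t t' : ℝ} (hle : t ≤ t')
    (hr : ∀ r ∈ Set.Icc t t', r ∉ τ.crossings τ.apex x) (he : τ.IsCorner e) (hxe : x ≠ e) :
    (Precedes (conf P t) x e ↔ Precedes (conf P t') x e) ∧
    (Precedes (conf P t) e x ↔ Precedes (conf P t') e x) :=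
  (precedes_iff_of_fst_ne hP.continuous hle
    fun r hr' h => hr r hr' ⟨e, Or.inr he, hxe, h⟩).2

lemma leftmost_iff (hP : IsPseudoAlgebraic k s P) {x : Fin n} {t t' : ℝ} (hle : t ≤ t')
    (hr : ∀ r ∈ Set.Icc t t', r ∉ τ.crossings τ.apex x) :
    (τ.left = (x : WithBot (Fin n)) ∨ After (conf P t) τ.left x) ↔
      (τ.left = (x : WithBot (Fin n)) ∨ After (conf P t') τ.left x) := by
  by_cases hx : τ.left = (x : WithBot (Fin n))
  · simp [hx]
  · simp only [hx, false_or, After]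
    refine forall_congr' fun i => ?_
    refine imp_congr_right fun hi => ?_
    exact (precedes_corner_iff hP hle hr (Or.inl hi) (by rintro rfl; exact hx hi)).2

lemma rightmost_iff (hP : IsPseudoAlgebraic k s P) {x : Fin n} {t t' : ℝ} (hle : t ≤ t')
    (hr : ∀ r ∈ Set.Icc t t', r ∉ τ.crossings τ.apex x) :
    (τ.right = (x : WithTop (Fin n)) ∨ Before (conf P t) x τ.right) ↔
      (τ.right = (x : WithTop (Fin n)) ∨ Before (conf P t') x τ.right) := by
  by_cases hx : τ.right = (x : WithTop (Fin n))
  · simp [hx]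
  · simp only [hx, false_or, Before]
    refine forall_congr' fun i => ?_
    refine imp_congr_right fun hi => ?_
    exact (precedes_corner_iff hP hle hr (Or.inr (Or.inr hi)) (by rintro rfl; exact hx hi)).1

lemma isCornerDetermined_QL (hP : IsPseudoAlgebraic k s P) :
    τ.IsCornerDetermined fun t => QL (conf P t) τ.left τ.apex where
  subset t ht x hx := by
    refine τ.mem_vertices.2 ?_
    by_cases hc : τ.IsCorner x
    · exact Or.inr hc
    · have h1 : x ≠ τ.apex := fun h => hc (Or.inr (Or.inl h))
      refine Or.inl ⟨h1, t, ht, hx.1.resolve_left fun h => hc (Or.inl h), fun i hi => ?_⟩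
      exact (hx.2.resolve_left h1).trans ((τ.between_apex ht).2 i hi)
  mem_iff x t _ t' _ hle hr := by
    refine and_congr (leftmost_iff hP hle hr) ?_
    by_cases hx : x = τ.apex
    · simp [hx]
    · simp only [hx, false_or]
      exact (precedes_corner_iff hP hle hr (Or.inr (Or.inl rfl)) hx).1

lemma isCornerDetermined_QR (hP : IsPseudoAlgebraic k s P) :
    τ.IsCornerDetermined fun t => QR (conf P t) τ.apex τ.right where
  subset t ht x hx := by
    refine τ.mem_vertices.2 ?_
    by_cases hc : τ.IsCorner x
    · exact Or.inr hc
    · have h1 : x ≠ τ.apex := fun h => hc (Or.inr (Or.inl h))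
      refine Or.inl ⟨h1, t, ht, fun i hi => ?_, hx.2.resolve_left fun h => hc (Or.inr (Or.inr h))⟩
      exact ((τ.between_apex ht).1 i hi).trans (hx.1.resolve_left h1)
  mem_iff x t _ t' _ hle hr := by
    refine and_congr ?_ (rightmost_iff hP hle hr)
    by_cases hx : x = τ.apex
    · simp [hx]
    · simp only [hx, false_or]
      exact (precedes_corner_iff hP hle hr (Or.inr (Or.inl rfl)) hx).2

variable (τ)

/-- The points of `S t` on the side of `p` given by the sign of `ε`. -/
def sideOf (P : Fin n → ℝ → ℝ × ℝ) (ε : ℝ) (p : Fin n) (S : ℝ → Set (Fin n)) (t : ℝ) :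
    Set (Fin n) :=
  {x | x ∈ S t ∧ 0 < ε * ((P x t).1 - (P p t).1)}

variable {τ}

/-- Besides crossing a corner, a point can change sides only by crossing `p`; this is why
`crossings` includes `p`. -/
lemma IsCornerDetermined.isEnvelopeDomain (hP : IsPseudoAlgebraic k s P)
    {S : ℝ → Set (Fin n)} (hS : τ.IsCornerDetermined S) {ε : ℝ} (hε : ε ≠ 0) (p : Fin n) :
    IsEnvelopeDomain P τ.lifespan ε p (τ.crossings p) (sideOf P ε p S) where
  side t x hx := hx.2
  mem_iff x t ht t' ht' hle hr := by
    refine and_congr (hS.mem_iff x t ht t' ht' hle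
      fun r hr' h => hr r hr' (τ.crossings_apex_subset p x h)) ?_
    by_cases hx : x = p
    · simp [hx]
    · have h1 := hP.continuous x
      have h2 := hP.continuous p
      exact pos_iff_of_ne_zero_on_Icc (f := fun r => ε * ((P x r).1 - (P p r).1)) (by fun_prop) hle
        fun r hr' => mul_ne_zero hε
          (sub_ne_zero.2 fun h => hr r hr' ⟨p, Or.inl rfl, hx, h⟩)

/-- The bound on the complexity of the slope envelopes. -/
noncomputable def envelopeBound (τ : PseudoTriangle P π) (k s : ℕ) : ℕ :=
  lam (s + 2) (τ.vertices.card * (4 * k + 1) + 1)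

lemma IsCornerDetermined.encard_breaks_slopeEnvelope_le (hP : IsPseudoAlgebraic k s P)
    {S : ℝ → Set (Fin n)} (hS : τ.IsCornerDetermined S) {ε : ℝ} (hε : ε ≠ 0) (p : Fin n) :
    (breaks (slopeEnvelope P ε p (sideOf P ε p S)) ∩ interior τ.lifespan).encard ≤
      τ.envelopeBound k s :=
  KineticTriangulation.encard_breaks_slopeEnvelope_le hP τ.ordConnected_lifespan hε
    (hS.isEnvelopeDomain hP hε p) (τ.encard_crossings_le hP p)
    (fun _ ht x => τ.notMem_crossings ht p x) τ.vertices
    fun t ht _ hx => hS.subset t ht hx.1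

/-! ### Changes of membership in a moving set and in its hull. -/

lemma breaks_inter_interior_subset {α : Type*} {g : ℝ → α} {J A : Set ℝ} (hA : A.Finite)
    (hg : ∀ t ∈ J, ∀ t' ∈ J, t ≤ t' → (∀ r ∈ Set.Icc t t', r ∉ A) → g t = g t') :
    breaks g ∩ interior J ⊆ A := by
  rintro t₀ ⟨ht, htJ⟩
  by_contra hA₀
  have hU : J ∩ Aᶜ ∈ 𝓝 t₀ :=
    inter_mem (mem_interior_iff_mem_nhds.1 htJ) (hA.isClosed.isOpen_compl.mem_nhds hA₀)
  obtain ⟨l, u, htlu, hsub⟩ := mem_nhds_iff_exists_Ioo_subset.1 hU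
  obtain ⟨t, h1, t', h2, -, -, hne⟩ := exists_ne_of_mem_breaks ht
    (mem_nhdsWithin_of_mem_nhds (Ioo_mem_nhds htlu.1 htlu.2))
  have hfree : ∀ t ∈ Set.Ioo l u, ∀ t' ∈ Set.Ioo l u, ∀ r ∈ Set.Icc t t', r ∉ A :=
    fun t h t' h' r hr => (hsub ⟨h.1.trans_le hr.1, hr.2.trans_lt h'.2⟩).2
  rcases le_total t t' with h | h
  · exact hne (hg t (hsub h1).1 t' (hsub h2).1 h (hfree t h1 t' h2))
  · exact hne (hg t' (hsub h2).1 t (hsub h1).1 h (hfree t' h2 t h1)).symm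

lemma IsCornerDetermined.encard_breaks_mem_le (hP : IsPseudoAlgebraic k s P)
    {S : ℝ → Set (Fin n)} (hS : τ.IsCornerDetermined S) (p : Fin n) :
    (breaks (fun t => p ∈ S t) ∩ interior τ.lifespan).encard ≤ (4 * k : ℕ) :=
  (Set.encard_le_encard (breaks_inter_interior_subset
    (Set.finite_of_encard_le_coe (τ.encard_crossings_le hP τ.apex p))
    fun t ht t' ht' hle hr => propext (hS.mem_iff p t ht t' ht' hle hr))).trans
      (τ.encard_crossings_le hP τ.apex p)

/-- Among all pairs, the binding one has least slope on the left (hence the factor `-1`) and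
greatest slope on the right. A side without points imposes no condition. -/
lemma mem_upperHull_iff_slopeEnvelope {t : ℝ} (ht : IsGeneric (conf P t)) {p : Fin n}
    {S : ℝ → Set (Fin n)} :
    p ∈ upperHull (conf P t) (S t) ↔ p ∈ S t ∧
      ∀ l, slopeEnvelope P (-1) p (sideOf P (-1) p S) t = some l →
        ∀ r, slopeEnvelope P 1 p (sideOf P 1 p S) t = some r → 0 < orient (conf P t) l r p := by
  rw [ht.mem_upperHull_iff]
  refine and_congr_right fun hp => ?_
  have hL : ∀ x, x ∈ sideOf P (-1) p S t ↔ x ∈ S t ∧ (conf P t x).1 < (conf P t p).1 := by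
    intro x
    simp [sideOf, conf]
  have hR : ∀ x, x ∈ sideOf P 1 p S t ↔ x ∈ S t ∧ (conf P t p).1 < (conf P t x).1 := by
    intro x
    simp [sideOf, conf]
  constructor
  · intro h l hl r hr
    have hl' := (hL l).1 (slopeEnvelope_spec hl).1
    have hr' := (hR r).1 (slopeEnvelope_spec hr).1
    exact h l hl'.1 r hr'.1 hl'.2 hr'.2
  · intro h l hl r hr hlp hpr
    cases hl₀ : slopeEnvelope P (-1) p (sideOf P (-1) p S) t with
    | none =>
      have := eq_empty_of_slopeEnvelope_eq_none hl₀
      exact absurd ((hL l).2 ⟨hl, hlp⟩) (by simp [this])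
    | some l₀ =>
      cases hr₀ : slopeEnvelope P 1 p (sideOf P 1 p S) t with
      | none =>
        have := eq_empty_of_slopeEnvelope_eq_none hr₀
        exact absurd ((hR r).2 ⟨hr, hpr⟩) (by simp [this])
      | some r₀ =>
        have h0 := h l₀ hl₀ r₀ hr₀
        obtain ⟨hl1, hl2⟩ := slopeEnvelope_spec hl₀
        obtain ⟨hr1, hr2⟩ := slopeEnvelope_spec hr₀
        have hl3 := hl2 l ((hL l).2 ⟨hl, hlp⟩)
        have hr3 := hr2 r ((hR r).2 ⟨hr, hpr⟩)
        rw [IsGeneric.orient_pos_iff_slope ((hL _).1 hl1).2 ((hR _).1 hr1).2] at h0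
        rw [IsGeneric.orient_pos_iff_slope hlp hpr]
        linarith

/-- The bound on the number of changes of hull membership of a point. -/
noncomputable def hullBound (τ : PseudoTriangle P π) (k s : ℕ) : ℕ :=
  4 * k + 2 * τ.envelopeBound k s + (4 * k + 2 * τ.envelopeBound k s + 1) * s

/-- Cells are cut out by the breaks of membership in `S` and of the two envelopes around `p`. Inside
a cell, hull membership is constant or is the orientation sign of one fixed triple, with at most `s`
changes over all cells having that triple. -/
lemma IsCornerDetermined.encard_breaks_upperHull_le (hP : IsPseudoAlgebraic k s P)
    {S : ℝ → Set (Fin n)} (hS : τ.IsCornerDetermined S) (p : Fin n) :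
    (breaks (fun t => p ∈ upperHull (conf P t) (S t)) ∩ interior τ.lifespan).encard ≤
      τ.hullBound k s := by
  set L := slopeEnvelope P (-1) p (sideOf P (-1) p S) with hLdef
  set R := slopeEnvelope P 1 p (sideOf P 1 p S) with hRdef
  have hgen : ∀ t₀ : ℝ, ∀ᶠ t in 𝓝[≠] t₀, IsGeneric (conf P t) := fun t₀ =>
    mem_nhdsNE_of_finite_compl hP.finite_compl_isGeneric t₀
  refine encard_breaks_le_of_cells (fun t => (p ∈ S t, L t, R t)) _
    τ.ordConnected_lifespan.interior ?_ ?_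
  · have hsub : breaks (fun t => (p ∈ S t, L t, R t)) ∩ interior τ.lifespan ⊆
        (breaks (fun t => p ∈ S t) ∩ interior τ.lifespan) ∪
          ((breaks L ∩ interior τ.lifespan) ∪ (breaks R ∩ interior τ.lifespan)) := by
      rintro t ⟨ht, htJ⟩
      rcases breaks_comp₂_subset Prod.mk (fun t => p ∈ S t) (fun t => (L t, R t)) ht with h | h
      · exact Or.inl ⟨h, htJ⟩
      · rcases breaks_comp₂_subset Prod.mk L R h with h | h
        · exact Or.inr (Or.inl ⟨h, htJ⟩)
        · exact Or.inr (Or.inr ⟨h, htJ⟩)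
    calc _ ≤ _ := Set.encard_le_encard hsub
      _ ≤ _ := Set.encard_union_le _ _
      _ ≤ ((4 * k : ℕ) : ℕ∞) + (τ.envelopeBound k s + τ.envelopeBound k s) := by
          refine add_le_add (hS.encard_breaks_mem_le hP p)
            ((Set.encard_union_le _ _).trans (add_le_add ?_ ?_))
          · exact hS.encard_breaks_slopeEnvelope_le hP (by norm_num) p
          · exact hS.encard_breaks_slopeEnvelope_le hP (by norm_num) p
      _ = _ := by push_cast; ring
  · rintro ⟨m, ol, or⟩
    rcases Set.eq_empty_or_nonempty {t₀ | t₀ ∈ breaks (fun t => p ∈ upperHull (conf P t) (S t)) ∩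
      interior τ.lifespan ∧ ∀ᶠ t in 𝓝[≠] t₀, (p ∈ S t, L t, R t) = (m, ol, or)} with he | hne
    · rw [he]; simp
    · obtain ⟨l, r, rfl, rfl, hlr, hrp, hlp⟩ : ∃ l r, ol = some l ∧ or = some r ∧
          l ≠ r ∧ r ≠ p ∧ l ≠ p := by
        obtain ⟨t₀, ⟨hbr, -⟩, hev⟩ := hne
        by_cases hol : ∃ l r, ol = some l ∧ or = some r
        · obtain ⟨l, r, rfl, rfl⟩ := hol
          obtain ⟨t, ht⟩ := hev.exists
          simp only [Prod.mk.injEq] at ht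
          have hl := (slopeEnvelope_spec ht.2.1).1.2
          have hr := (slopeEnvelope_spec ht.2.2).1.2
          refine ⟨l, r, rfl, rfl, ?_, ?_, ?_⟩
          · rintro rfl; linarith
          · rintro rfl; simp at hr
          · rintro rfl; simp at hl
        -- With one side empty, hull membership is just membership in `S`, which is constant in the
        -- cell.
        · exfalso
          refine hbr ⟨m, ?_⟩
          filter_upwards [hev, hgen t₀] with t ht htg
          simp only [Prod.mk.injEq] at ht
          rw [mem_upperHull_iff_slopeEnvelope htg, ← ht.1]
          refine propext (and_iff_left fun l hl r hr => ?_)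
          exact absurd ⟨l, r, ht.2.1.symm.trans hl, ht.2.2.symm.trans hr⟩ hol
      refine le_trans (Set.encard_le_encard ?_) (hP.collinear l r p hlr hrp hlp)
      rintro t₀ ⟨⟨hbr, -⟩, hev⟩
      have h1 : t₀ ∈ breaks (fun t => m ∧ 0 < orient (conf P t) l r p) := by
        refine mem_breaks_of_eventuallyEq hbr ?_
        filter_upwards [hev, hgen t₀] with t ht htg
        simp only [Prod.mk.injEq] at ht
        rw [mem_upperHull_iff_slopeEnvelope htg, ← ht.1, ← hLdef, ← hRdef, ht.2.1, ht.2.2]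
        simp
      have h2 := breaks_pos_subset (continuous_orient hP.continuous l r p)
        (breaks_comp_subset (fun q => m ∧ q) _ h1)
      exact collinear_of_orient_eq_zero (z := conf P t₀) h2

end PseudoTriangle

/-! ### Counting the envelope and visibility events. -/

namespace PseudoTriangle

variable {n k s : ℕ} {P : Fin n → ℝ → ℝ × ℝ} {π : Equiv.Perm (Fin n)} {τ : PseudoTriangle P π}

lemma eventually_generic (hP : IsPseudoAlgebraic k s P) {t₀ : ℝ}
    (ht₀ : t₀ ∈ interior τ.lifespan) :
    ∀ᶠ t in 𝓝[≠] t₀, IsGeneric (conf P t) ∧ t ∈ τ.lifespan :=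
  Filter.Eventually.and (mem_nhdsNE_of_finite_compl hP.finite_compl_isGeneric t₀)
    (mem_nhdsWithin_of_mem_nhds (mem_interior_iff_mem_nhds.1 ht₀))

lemma mem_breaks_of_switches {A B : ℝ → Prop} {F : ℝ → Prop} {t₀ : ℝ}
    {G : ℝ → Prop} (hG : ∀ᶠ t in 𝓝[≠] t₀, G t)
    (hA : ∀ t, G t → A t → ¬ F t) (hB : ∀ t, G t → B t → F t)
    (h : Switches A B t₀ ∨ Switches B A t₀) : t₀ ∈ breaks F := by
  have hl : ∀ᶠ t in 𝓝[<] t₀, G t :=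
    hG.filter_mono (nhdsWithin_mono _ fun t (ht : t < t₀) => ht.ne)
  have hr : ∀ᶠ t in 𝓝[>] t₀, G t :=
    hG.filter_mono (nhdsWithin_mono _ fun t (ht : t₀ < t) => ht.ne')
  have hA' : ∀ t, G t → A t → F t = False := fun t h1 h2 => eq_false (hA t h1 h2)
  have hB' : ∀ t, G t → B t → F t = True := fun t h1 h2 => eq_true (hB t h1 h2)
  rcases h with ⟨h1, h2⟩ | ⟨h1, h2⟩
  · exact mem_breaks_of_eventually (x := False) (y := True) (by simp)
      (by filter_upwards [h1, hl] with t h h' using hA' t h' h)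
      (by filter_upwards [h2, hr] with t h h' using hB' t h' h)
  · exact mem_breaks_of_eventually (x := True) (y := False) (by simp)
      (by filter_upwards [h1, hl] with t h h' using hB' t h' h)
      (by filter_upwards [h2, hr] with t h h' using hA' t h' h)

/-- A joining or leaving of the left chain changes whether the point is a vertex of the hull of
`Q_L` but not of the hull of the whole set. -/
lemma mem_breaks_of_joinsOrLeaves_leftChain (hP : IsPseudoAlgebraic k s P) {t₀ : ℝ}
    (ht₀ : t₀ ∈ interior τ.lifespan) {p : Fin n} (hp : p ≠ τ.apex)
    (h : τ.JoinsOrLeaves (fun t => leftChain (conf P t) τ.left τ.apex τ.right) p t₀) :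
    t₀ ∈ breaks fun t => p ∈ upperHull (conf P t) (QL (conf P t) τ.left τ.apex) ∧
      ¬ p ∈ upperHull (conf P t)
        (QL (conf P t) τ.left τ.apex ∪ QR (conf P t) τ.apex τ.right) :=
  mem_breaks_of_switches (eventually_generic hP ht₀)
    (fun _ hG hA hF => hA (hG.1.mem_leftChain_of_notMem_upperHull (τ.between_apex hG.2)
      hF.1 hp hF.2))
    (fun _ hG hB => ⟨hB.1.1, hG.1.notMem_upperHull_of_mem_leftChain hB.1 hp hB.2⟩) h

lemma mem_breaks_of_joinsOrLeaves_rightChain (hP : IsPseudoAlgebraic k s P) {t₀ : ℝ}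
    (ht₀ : t₀ ∈ interior τ.lifespan) {p : Fin n} (hp : p ≠ τ.apex)
    (h : τ.JoinsOrLeaves (fun t => rightChain (conf P t) τ.left τ.apex τ.right) p t₀) :
    t₀ ∈ breaks fun t => p ∈ upperHull (conf P t) (QR (conf P t) τ.apex τ.right) ∧
      ¬ p ∈ upperHull (conf P t)
        (QL (conf P t) τ.left τ.apex ∪ QR (conf P t) τ.apex τ.right) :=
  mem_breaks_of_switches (eventually_generic hP ht₀)
    (fun _ hG hA hF => hA (hG.1.mem_rightChain_of_notMem_upperHull (τ.between_apex hG.2)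
      hF.1 hp hF.2))
    (fun _ hG hB => ⟨hB.1.1, hG.1.notMem_upperHull_of_mem_rightChain hB.1 hp hB.2⟩) h

/-- The apex never leaves its chains, so it takes part in no envelope event; the description of the
chains by hulls does not cover it. -/
lemma apex_mem_leftChain {t : ℝ} (ht : IsGeneric (conf P t)) (htJ : t ∈ τ.lifespan) :
    τ.apex ∈ leftChain (conf P t) τ.left τ.apex τ.right :=
  ⟨ht.mem_upperHull_iff.2 ⟨IsGeneric.apex_mem_QL (τ.between_apex htJ),
    fun _ _ _ hr _ hbr => absurd (ht.le_of_mem_QL hr) (not_le.2 hbr)⟩, Or.inl rfl⟩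

lemma apex_mem_rightChain {t : ℝ} (ht : IsGeneric (conf P t)) (htJ : t ∈ τ.lifespan) :
    τ.apex ∈ rightChain (conf P t) τ.left τ.apex τ.right :=
  ⟨ht.mem_upperHull_iff.2 ⟨IsGeneric.apex_mem_QR (τ.between_apex htJ),
    fun _ hl _ _ hlb _ => absurd (ht.le_of_mem_QR hl) (not_le.2 hlb)⟩, Or.inl rfl⟩

/-- A point that joins or leaves a chain is on the chain at some nearby time, and off it at some
other nearby time. -/
lemma exists_of_joinsOrLeaves {C : ℝ → Set (Fin n)} {p : Fin n} {t₀ : ℝ}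
    (h : τ.JoinsOrLeaves C p t₀) {G : ℝ → Prop} (hG : ∀ᶠ t in 𝓝[≠] t₀, G t) :
    (∃ t, G t ∧ p ∈ C t) ∧ ∃ t, G t ∧ p ∉ C t := by
  have hl : ∀ᶠ t in 𝓝[<] t₀, G t :=
    hG.filter_mono (nhdsWithin_mono _ fun t (ht : t < t₀) => ht.ne)
  have hr : ∀ᶠ t in 𝓝[>] t₀, G t :=
    hG.filter_mono (nhdsWithin_mono _ fun t (ht : t₀ < t) => ht.ne')
  rcases h with ⟨h1, h2⟩ | ⟨h1, h2⟩
  · obtain ⟨t, k1, k2⟩ := (hl.and h1).exists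
    obtain ⟨t', k3, k4⟩ := (hr.and h2).exists
    exact ⟨⟨t', k3, k4.1⟩, t, k1, k2⟩
  · obtain ⟨t, k1, k2⟩ := (hl.and h1).exists
    obtain ⟨t', k3, k4⟩ := (hr.and h2).exists
    exact ⟨⟨t, k1, k2.1⟩, t', k3, k4⟩

lemma encard_breaks_and_le (hP : IsPseudoAlgebraic k s P) {S S' : ℝ → Set (Fin n)}
    (hS : τ.IsCornerDetermined S) (hS' : τ.IsCornerDetermined S') (p : Fin n) :
    (breaks (fun t => p ∈ upperHull (conf P t) (S t) ∧ ¬ p ∈ upperHull (conf P t) (S' t)) ∩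
      interior τ.lifespan).encard ≤ (2 * τ.hullBound k s : ℕ) := by
  have hsub : breaks (fun t => p ∈ upperHull (conf P t) (S t) ∧
      ¬ p ∈ upperHull (conf P t) (S' t)) ∩ interior τ.lifespan ⊆
      (breaks (fun t => p ∈ upperHull (conf P t) (S t)) ∩ interior τ.lifespan) ∪
      (breaks (fun t => p ∈ upperHull (conf P t) (S' t)) ∩ interior τ.lifespan) := by
    rw [← Set.union_inter_distrib_right]
    exact Set.inter_subset_inter_left _ (breaks_comp₂_subset (fun a b : Prop => a ∧ ¬ b) _ _)
  calc _ ≤ _ := Set.encard_le_encard hsub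
    _ ≤ _ := Set.encard_union_le _ _
    _ ≤ (τ.hullBound k s : ℕ∞) + τ.hullBound k s :=
        add_le_add (hS.encard_breaks_upperHull_le hP p) (hS'.encard_breaks_upperHull_le hP p)
    _ = _ := by push_cast; ring

/-- The factor 4: for each of the two chains, membership in two hulls is followed. -/
lemma encard_envelopeEvents_le (hP : IsPseudoAlgebraic k s P) :
    τ.envelopeEvents.encard ≤ (τ.vertices.card * (4 * τ.hullBound k s) : ℕ) := by
  have hL := isCornerDetermined_QL (τ := τ) hP
  have hR := isCornerDetermined_QR (τ := τ) hP
  have hne : ∀ e ∈ τ.envelopeEvents, e.2 ≠ τ.apex := by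
    rintro ⟨t₀, p⟩ ⟨ht₀, h⟩ (rfl : p = τ.apex)
    have hG := eventually_generic hP ht₀.1
    rcases h with h | h
    · obtain ⟨t, hGt, ht⟩ := (exists_of_joinsOrLeaves h hG).2
      exact ht (apex_mem_leftChain hGt.1 hGt.2)
    · obtain ⟨t, hGt, ht⟩ := (exists_of_joinsOrLeaves h hG).2
      exact ht (apex_mem_rightChain hGt.1 hGt.2)
  refine encard_le_card_mul_of_fibers _ _ _ ?_ ?_
  · rintro ⟨t₀, p⟩ ⟨ht₀, h⟩
    have hG := eventually_generic hP ht₀.1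
    rcases h with h | h
    · obtain ⟨t, hGt, ht⟩ := (exists_of_joinsOrLeaves h hG).1
      exact hL.subset t hGt.2 ht.1.1
    · obtain ⟨t, hGt, ht⟩ := (exists_of_joinsOrLeaves h hG).1
      exact hR.subset t hGt.2 ht.1.1
  · intro p
    have hsub : {t | (t, p) ∈ τ.envelopeEvents} ⊆ _ ∪ _ := fun t₀ ht => by
      have hp := hne _ ht
      exact ht.2.imp
        (fun h => (⟨mem_breaks_of_joinsOrLeaves_leftChain hP ht.1.1 hp h, ht.1.1⟩ :
          t₀ ∈ _ ∩ interior τ.lifespan))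
        (fun h => (⟨mem_breaks_of_joinsOrLeaves_rightChain hP ht.1.1 hp h, ht.1.1⟩ :
          t₀ ∈ _ ∩ interior τ.lifespan))
    calc _ ≤ _ := Set.encard_le_encard hsub
      _ ≤ _ := Set.encard_union_le _ _
      _ ≤ ((2 * τ.hullBound k s : ℕ) : ℕ∞) + (2 * τ.hullBound k s : ℕ) :=
          add_le_add (encard_breaks_and_le hP hL (hL.union τ hR) p)
            (encard_breaks_and_le hP hR (hL.union τ hR) p)
      _ = _ := by push_cast; ring

open Classical in
/-- The slope-extremal point of the opposite side of the apex, as seen from `q`. -/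
noncomputable def tangentPoint (τ : PseudoTriangle P π) (q : Fin n) (t : ℝ) : Option (Fin n) :=
  if Precedes (conf P t) q τ.apex then
    slopeEnvelope P 1 q (sideOf P 1 q fun t => QR (conf P t) τ.apex τ.right) t
  else slopeEnvelope P (-1) q (sideOf P (-1) q fun t => QL (conf P t) τ.left τ.apex) t

/-- The tangent point is defined whether or not `q` is on the funnel and agrees with `ν(q)` whenever
the latter exists, so every change of `ν(q)` is a break of an envelope. -/
lemma tangentPoint_eq_of_isNu (hP : IsPseudoAlgebraic k s P) {t : ℝ}
    (ht : IsGeneric (conf P t)) (htJ : t ∈ τ.lifespan) {q p : Fin n}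
    (h : IsNu (conf P t) τ.left τ.apex τ.right q p) : τ.tangentPoint q t = some p := by
  have hb := τ.between_apex htJ
  rcases h with ⟨hvis, hmax⟩ | ⟨hvis, hmin⟩
  · have hqb := ht.fst_lt_of_le (ht.le_of_mem_QL hvis.1.1.1) hvis.2.1
    rw [tangentPoint, if_pos (ht.precedes_iff.2 hqb)]
    have hqp := hqb.trans_le (ht.le_of_mem_QR hvis.2.2.1.1.1)
    refine slopeEnvelope_eq_some ((isCornerDetermined_QR hP).isEnvelopeDomain hP one_ne_zero q)
      one_ne_zero ht ⟨hvis.2.2.1.1.1, by simpa [conf] using hqp⟩ fun y hy => ?_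
    have := ht.slopeOf_le_of_rightmost_visible hb hvis hmax y hy.1
    linarith
  · have hbq := ht.fst_lt_of_le (ht.le_of_mem_QR hvis.2.2.1.1.1) hvis.2.2.2.1.symm
    rw [tangentPoint, if_neg (by rw [ht.precedes_iff]; exact hbq.not_gt)]
    have hqp := (ht.le_of_mem_QL hvis.1.1.1).trans_lt hbq
    have h1 : (-1 : ℝ) ≠ 0 := by norm_num
    refine slopeEnvelope_eq_some ((isCornerDetermined_QL hP).isEnvelopeDomain hP h1 q)
      h1 ht ⟨hvis.1.1.1, by simpa [conf] using hqp⟩ fun y hy => ?_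
    have := ht.le_slopeOf_of_leftmost_visible hb hvis hmin y hy.1
    linarith

lemma mem_vertices_of_isNu (hP : IsPseudoAlgebraic k s P) {t : ℝ} (htJ : t ∈ τ.lifespan)
    {q p : Fin n} (h : IsNu (conf P t) τ.left τ.apex τ.right q p) : q ∈ τ.vertices := by
  rcases h with ⟨hvis, -⟩ | ⟨hvis, -⟩
  · exact (isCornerDetermined_QL hP).subset t htJ hvis.1.1.1
  · exact (isCornerDetermined_QR hP).subset t htJ hvis.2.2.1.1.1

lemma encard_breaks_tangentPoint_le (hP : IsPseudoAlgebraic k s P) (q : Fin n) :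
    (breaks (τ.tangentPoint q) ∩ interior τ.lifespan).encard ≤ τ.hullBound k s := by
  classical
  have hbr : (breaks (fun t => Precedes (conf P t) q τ.apex) ∩ interior τ.lifespan) ⊆
      τ.crossings τ.apex q := by
    refine breaks_inter_interior_subset
      (Set.finite_of_encard_le_coe (τ.encard_crossings_le hP τ.apex q)) ?_
    intro t _ t' _ hle hr
    by_cases hq : q = τ.apex
    · simp [hq, Precedes]
    · exact propext (precedes_corner_iff hP hle hr (Or.inr (Or.inl rfl)) hq).1
  have hsub : breaks (τ.tangentPoint q) ∩ interior τ.lifespan ⊆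
      τ.crossings τ.apex q ∪
      ((breaks (slopeEnvelope P 1 q (sideOf P 1 q fun t => QR (conf P t) τ.apex τ.right)) ∩
        interior τ.lifespan) ∪
      (breaks (slopeEnvelope P (-1) q (sideOf P (-1) q fun t => QL (conf P t) τ.left τ.apex)) ∩
        interior τ.lifespan)) := by
    rintro t ⟨ht, htJ⟩
    rcases breaks_comp₂_subset (fun (a : Prop) (o : Option (Fin n) × Option (Fin n)) =>
      if a then o.1 else o.2) (fun t => Precedes (conf P t) q τ.apex) (fun t => (_, _)) ht
      with h | h
    · exact Or.inl (hbr ⟨h, htJ⟩)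
    · rcases breaks_comp₂_subset Prod.mk _ _ h with h | h
      · exact Or.inr (Or.inl ⟨h, htJ⟩)
      · exact Or.inr (Or.inr ⟨h, htJ⟩)
  calc _ ≤ _ := Set.encard_le_encard hsub
    _ ≤ _ := Set.encard_union_le _ _
    _ ≤ ((4 * k : ℕ) : ℕ∞) + (τ.envelopeBound k s + τ.envelopeBound k s) := by
        refine add_le_add (τ.encard_crossings_le hP τ.apex q)
          ((Set.encard_union_le _ _).trans (add_le_add ?_ ?_))
        · exact (isCornerDetermined_QR hP).encard_breaks_slopeEnvelope_le hP one_ne_zero q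
        · exact (isCornerDetermined_QL hP).encard_breaks_slopeEnvelope_le hP (by norm_num) q
    _ = ((4 * k + 2 * τ.envelopeBound k s : ℕ) : ℕ∞) := by push_cast; ring
    _ ≤ _ := by
        refine Nat.cast_le.2 ?_
        unfold hullBound
        exact Nat.le_add_right _ _

/-- The extra fibre over `none` holds the bridge events, which are hull changes of the apex in `Q_L
∪ Q_R`. -/
lemma encard_visibilityEvents_le (hP : IsPseudoAlgebraic k s P) :
    τ.visibilityEvents.encard ≤ ((τ.vertices.card + 1) * τ.hullBound k s : ℕ) := by
  classical
  have hcard : (insert none (τ.vertices.image some)).card ≤ τ.vertices.card + 1 :=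
    (Finset.card_insert_le _ _).trans (Nat.add_le_add_right Finset.card_image_le _)
  refine le_trans (encard_le_card_mul_of_fibers τ.visibilityEvents
    (insert none (τ.vertices.image some)) (τ.hullBound k s) ?_ ?_)
    (Nat.cast_le.2 (Nat.mul_le_mul_right _ hcard))
  · rintro ⟨t₀, o⟩ ⟨ht₀, ⟨q, rfl, p, r, -, h, -⟩ | ⟨rfl, -⟩⟩
    · have hG : ∀ᶠ t in 𝓝[<] t₀, IsGeneric (conf P t) ∧ t ∈ τ.lifespan :=
        (eventually_generic hP ht₀.1).filter_mono (nhdsWithin_mono _ fun t (ht : t < t₀) => ht.ne)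
      obtain ⟨t, h1, h2⟩ := (hG.and h).exists
      simp [mem_vertices_of_isNu hP h1.2 h2]
    · simp
  · rintro (_ | q)
    · refine le_trans (Set.encard_le_encard ?_)
        (((isCornerDetermined_QL hP).union τ (isCornerDetermined_QR hP)).encard_breaks_upperHull_le
          hP τ.apex)
      rintro t₀ ⟨ht₀, ⟨q, hq, -⟩ | ⟨-, h⟩⟩
      · simp at hq
      · refine ⟨mem_breaks_of_switches (eventually_generic hP ht₀.1)
          (fun t hG hA hF => hA ((hG.1.funnelEmpty_iff (τ.between_apex hG.2)).2 hF))
          (fun t hG hB => (hG.1.funnelEmpty_iff (τ.between_apex hG.2)).1 hB) h.symm, ht₀.1⟩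
    · refine le_trans (Set.encard_le_encard ?_) (encard_breaks_tangentPoint_le hP q)
      rintro t₀ ⟨ht₀, ⟨q', hq', p, r, hpr, h1, h2⟩ | ⟨hq', -⟩⟩
      · obtain rfl := Option.some.inj hq'
        have hG := eventually_generic hP ht₀.1
        have hl := hG.filter_mono (nhdsWithin_mono _ fun t (ht : t < t₀) => ht.ne)
        have hr := hG.filter_mono (nhdsWithin_mono _ fun t (ht : t₀ < t) => ht.ne')
        refine ⟨mem_breaks_of_eventually (x := some p) (y := some r) (by simpa using hpr) ?_ ?_,
          ht₀.1⟩
        · filter_upwards [hl, h1] with t hg h using tangentPoint_eq_of_isNu hP hg.1 hg.2 h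
        · filter_upwards [hr, h2] with t hg h using tangentPoint_eq_of_isNu hP hg.1 hg.2 h
      · simp at hq'

variable (k s) in
lemma exists_hullBound_le : ∃ C : ℕ, ∀ (n : ℕ) (P : Fin n → ℝ → ℝ × ℝ)
    (π : Equiv.Perm (Fin n)) (τ : PseudoTriangle P π), 0 < τ.N →
      τ.hullBound k s ≤ C * lam (s + 2) τ.N := by
  -- For `N ≥ 1` there are at most `N + 3 ≤ 4 * N` vertices, hence at most `4 * N * (4 * k + 1) + 1
  -- ≤ (16 * k + 5) * N` symbols.
  obtain ⟨C₀, hC₀⟩ := exists_lam_mul_le (s + 2) (16 * k + 5)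
  refine ⟨(4 * k + 2 * C₀) * (s + 1) + s, fun n P π τ hN => ?_⟩
  have h1 : τ.envelopeBound k s ≤ C₀ * lam (s + 2) τ.N := by
    refine le_trans (lam_mono _ ?_) (hC₀ τ.N hN)
    have h2 := τ.card_vertices_le
    have h3 : τ.vertices.card ≤ 4 * τ.N := by omega
    calc τ.vertices.card * (4 * k + 1) + 1 ≤ 4 * τ.N * (4 * k + 1) + τ.N :=
          Nat.add_le_add (Nat.mul_le_mul_right _ h3) hN
      _ = (16 * k + 5) * τ.N := by ring
  have hL := one_le_lam (s + 2) hN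
  have h2 : 4 * k + 2 * τ.envelopeBound k s ≤ (4 * k + 2 * C₀) * lam (s + 2) τ.N := by
    have := Nat.mul_le_mul_left (4 * k) hL
    calc 4 * k + 2 * τ.envelopeBound k s
        ≤ 4 * k * lam (s + 2) τ.N + 2 * (C₀ * lam (s + 2) τ.N) := by omega
      _ = _ := by ring
  calc τ.hullBound k s
      = (4 * k + 2 * τ.envelopeBound k s) * (s + 1) + s * 1 := by unfold hullBound; ring
    _ ≤ (4 * k + 2 * C₀) * lam (s + 2) τ.N * (s + 1) + s * lam (s + 2) τ.N :=
        Nat.add_le_add (Nat.mul_le_mul_right _ h2) (Nat.mul_le_mul_left _ hL)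
    _ = _ := by ring

end PseudoTriangle

lemma sq_mul_beta (m : ℕ) {N : ℕ} (hN : 0 < N) : (N : ℝ) ^ 2 * beta m N = (N * lam m N : ℕ) := by
  have : (N : ℝ) ≠ 0 := by positivity
  unfold beta
  push_cast
  field_simp

lemma finite_and_ncard_le {α : Type*} {S : Set α} {K : ℕ} (h : S.encard ≤ K) :
    S.Finite ∧ S.ncard ≤ K := by
  have hf := Set.finite_of_encard_le_coe h
  rw [← hf.cast_ncard_eq] at h
  exact ⟨hf, by exact_mod_cast h⟩

end KineticTriangulation

theorem mainTheorem4 (k s : ℕ) :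
    ∃ C : ℝ, ∀ (n : ℕ) (P : Fin n → ℝ → ℝ × ℝ) (π : Equiv.Perm (Fin n)),
      KineticTriangulation.IsPseudoAlgebraic k s P →
      ∀ τ : KineticTriangulation.PseudoTriangle P π, 0 < τ.N →
        (τ.visibilityEvents.Finite ∧
          (τ.V : ℝ) ≤ C * ((τ.N : ℝ) ^ 2 * KineticTriangulation.beta (s + 2) τ.N)) ∧
        (τ.envelopeEvents.Finite ∧
          (τ.E : ℝ) ≤ C * ((τ.N : ℝ) ^ 2 * KineticTriangulation.beta (s + 2) τ.N)) := by
  obtain ⟨C, hC⟩ := KineticTriangulation.PseudoTriangle.exists_hullBound_le k s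
  -- For envelope events, 16 is 4 from `N + 3 ≤ 4 * N` times the 4 hull memberships per point; it is
  -- more than enough for visibility events.
  refine ⟨(16 * C : ℕ), fun n P π hP τ hN => ?_⟩
  have hB := hC n P π τ hN
  have hcard := τ.card_vertices_le
  obtain ⟨hVf, hV⟩ := KineticTriangulation.finite_and_ncard_le
    (KineticTriangulation.PseudoTriangle.encard_visibilityEvents_le (τ := τ) hP)
  obtain ⟨hEf, hE⟩ := KineticTriangulation.finite_and_ncard_le
    (KineticTriangulation.PseudoTriangle.encard_envelopeEvents_le (τ := τ) hP)
  rw [KineticTriangulation.sq_mul_beta _ hN]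
  refine ⟨⟨hVf, ?_⟩, hEf, ?_⟩
  · have h : τ.V ≤ 16 * C * (τ.N * KineticTriangulation.lam (s + 2) τ.N) := by
      calc τ.V ≤ _ := hV
        _ ≤ (16 * τ.N) * (C * KineticTriangulation.lam (s + 2) τ.N) :=
            Nat.mul_le_mul (by omega) hB
        _ = _ := by ring
    exact_mod_cast h
  · have h : τ.E ≤ 16 * C * (τ.N * KineticTriangulation.lam (s + 2) τ.N) := by
      calc τ.E ≤ _ := hE
        _ ≤ (4 * τ.N) * (4 * (C * KineticTriangulation.lam (s + 2) τ.N)) :=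
            Nat.mul_le_mul (by omega) (Nat.mul_le_mul_left _ hB)
        _ = _ := by ring
    exact_mod_cast h
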